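/- Let $R$ be a commutative artinian ring and let $\Lambda$ be an artin $R$-algebra (an $R$-algebra that is finitely generated as an $R$-module). For such a ring, $\mathrm{mod}\,\Lambda$ denotes the category of finitely generated left $\Lambda$-modules. Let $K_0$ be the abelian group generated by the symbols $[M]$, $M\in\mathrm{mod}\,\Lambda$, modulo the relations $[C]=[A]+[B]$ if $C\simeq A\oplus B$, and $[P]=0$ if $P$ is projective. Let $\Omega:K_0\to K_0$ be the homomorphism induced by the syzygy, $\Omega([M])=[\Omega M]$, and for $M\in\mathrm{mod}\,\Lambda$ let $\langle\mathrm{add}\,M\rangle\subseteq K_0$ be the subgroup generated by the classes of the indecomposable direct summands of $M$. Then $\phi_l^\Lambda(M)$ is the smallest integer $n\ge 0$ such that $\Omega:\Omega^s\langle\mathrm{add}\,M\rangle\to\Omega^{s+1}\langle\mathrm{add}\,M\rangle$ is an isomorphism for all $s\ge n$, and $\phi_l\dim(\Lambda)=\sup\{\phi_l^\Lambda(M): M\in\mathrm{mod}\,\Lambda\}\in\mathbb N\cup\{\infty\}$. Dually, $\phi_r^\Lambda(M)$ and $\phi_r\dim(\Lambda)$ are defined with injective modules instead of projective ones and with cosyzygies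 $\Omega^{-1}M$ instead of syzygies. Let $\mathfrak A$ be a strong idempotent ideal of $\Lambda$, that is, a two-sided ideal such that for all $X,Y\in\mathrm{mod}\,\Lambda/\mathfrak A$ and all $i\ge 0$ the canonical map $\mathrm{Ext}^i_{\Lambda/\mathfrak A}(X,Y)\to\mathrm{Ext}^i_\Lambda(X,Y)$ is an isomorphism. (1) If the left $\Lambda$-module $\Lambda/\mathfrak A$ has finite projective dimension, then (a) $\phi_l^{\Lambda/\mathfrak A}(X)\le\phi_l^{\Lambda}(X)$ for all $X\in\mathrm{mod}\,\Lambda/\mathfrak A$, and (b) $\phi_l\dim(\Lambda/\mathfrak A)\le\phi_l\dim(\Lambda)$. (2) Dually, if the right $\Lambda$-module $\Lambda/\mathfrak A$ has finite projective dimension, then (a) $\phi_r^{\Lambda/\mathfrak A}(X)\le\phi_r^{\Lambda}(X)$ for all $X\in\mathrm{mod}\,\Lambda/\mathfrak A$, and (b) $\phi_r\dim(\Lambda/\mathfrak A)\le\phi_r\dim(\Lambda)$. -/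

import Mathlib

open CategoryTheory

universe u v

namespace IgusaTodorov

noncomputable section

/-! ### The stable Grothendieck groups of `mod Λ` -/

section StableGroup

variable {Λ : Type u} [Ring Λ]

/-- The relations imposed on the free abelian group on the finitely generated left `Λ`-modules:
`[C] = [A] + [B]` whenever `C ≃ A ⊕ B`, and `[Z] = 0` whenever `Z` belongs to the given class. -/
inductive StableRel (Null : FGModuleCat.{u} Λ → Prop) :
    FreeAbelianGroup (FGModuleCat.{u} Λ) → Prop
  | sum (A B C : FGModuleCat.{u} Λ) (e : C ≃ₗ[Λ] (A × B)) :
      StableRel Null (FreeAbelianGroup.of C - (FreeAbelianGroup.of A + FreeAbelianGroup.of B))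
  | null (Z : FGModuleCat.{u} Λ) (hZ : Null Z) : StableRel Null (FreeAbelianGroup.of Z)

/-- The abelian group generated by all symbols `[M]`, `M` in `mod Λ`, modulo the relations
`StableRel`. -/
abbrev StableK (Null : FGModuleCat.{u} Λ → Prop) : Type (u + 1) :=
  FreeAbelianGroup (FGModuleCat.{u} Λ) ⧸ AddSubgroup.closure {x | StableRel Null x}

/-- The class `[M]`. -/
def cls (Null : FGModuleCat.{u} Λ → Prop) (M : FGModuleCat.{u} Λ) : StableK Null :=
  QuotientAddGroup.mk (FreeAbelianGroup.of M)

/-- The module is projective. -/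
def Proj (P : FGModuleCat.{u} Λ) : Prop := Module.Projective Λ P

/-- The module is injective. -/
def Inj (I : FGModuleCat.{u} Λ) : Prop := Module.Injective Λ I

/-- `N` is a first syzygy of `M`: there is an exact sequence `0 → N → P → M → 0` in `mod Λ` with `P`
projective. (The kernel of a projective cover is one; any two become equal in the stable group.) -/
def IsSyzygy (M N : FGModuleCat.{u} Λ) : Prop :=
  ∃ (P : FGModuleCat.{u} Λ) (f : N →ₗ[Λ] P) (g : P →ₗ[Λ] M), Proj P ∧
    Function.Injective f ∧ Function.Exact f g ∧ Function.Surjective g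

/-- `N` is a first cosyzygy of `M`: there is an exact sequence `0 → M → I → N → 0` in `mod Λ` with
`I` injective. -/
def IsCosyzygy (M N : FGModuleCat.{u} Λ) : Prop :=
  ∃ (I : FGModuleCat.{u} Λ) (f : M →ₗ[Λ] I) (g : I →ₗ[Λ] N), Inj I ∧
    Function.Injective f ∧ Function.Exact f g ∧ Function.Surjective g

/-- The endomorphism `ω` of the stable group satisfies `ω [M] = [N]` whenever `N` is a (co)syzygy
of `M`. -/
def IsInduced (Null : FGModuleCat.{u} Λ → Prop)
    (Syz : FGModuleCat.{u} Λ → FGModuleCat.{u} Λ → Prop) (ω : StableK Null →+ StableK Null) : Prop :=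
  ∀ M N : FGModuleCat.{u} Λ, Syz M N → ω (cls Null M) = cls Null N

open Classical in
/-- The endomorphism of the stable group induced by the (co)syzygy. For an artin algebra it exists
and is unique, see `existsUnique_isInduced_syzygy` and `existsUnique_isInduced_cosyzygy`. -/
def inducedHom (Null : FGModuleCat.{u} Λ → Prop)
    (Syz : FGModuleCat.{u} Λ → FGModuleCat.{u} Λ → Prop) : StableK Null →+ StableK Null :=
  if h : ∃ ω, IsInduced Null Syz ω then h.choose else 0

/-! ### The Igusa-Todorov functions -/

/-- `N` is an indecomposable module. -/
def IsIndecomposable (N : FGModuleCat.{u} Λ) : Prop :=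
  Nontrivial N ∧ ∀ p q : Submodule Λ N, IsCompl p q → p = ⊥ ∨ q = ⊥

/-- `N` is isomorphic to a direct summand of `M`. -/
def IsSummand (N M : FGModuleCat.{u} Λ) : Prop :=
  ∃ L : FGModuleCat.{u} Λ, Nonempty (M ≃ₗ[Λ] (N × L))

/-- The subgroup `⟨add M⟩` generated by the classes of the indecomposable summands of `M`. -/
def addSpan (Null : FGModuleCat.{u} Λ → Prop) (M : FGModuleCat.{u} Λ) :
    AddSubgroup (StableK Null) :=
  AddSubgroup.closure {x | ∃ N, IsIndecomposable N ∧ IsSummand N M ∧ x = cls Null N}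

/-- For an endomorphism `ω` of an abelian group and a subgroup `H`, the smallest `n` such that
`ω : ω^s(H) → ω^(s+1)(H)` is an isomorphism for all `s ≥ n` (and `⊤` if there is none). -/
def stabIndex {K : Type*} [AddCommGroup K] (ω : K →+ K) (H : AddSubgroup K) : ℕ∞ :=
  ⨅ (n : ℕ) (_ : ∀ s, n ≤ s → Set.BijOn ω (ω^[s] '' (H : Set K)) (ω^[s + 1] '' (H : Set K))),
    (n : ℕ∞)

/-- The Igusa-Todorov function `φ_l`, defined by the syzygy. -/
def phiL (M : FGModuleCat.{u} Λ) : ℕ∞ :=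
  stabIndex (inducedHom Proj (IsSyzygy (Λ := Λ))) (addSpan Proj M)

/-- The dual Igusa-Todorov function `φ_r`, defined by the cosyzygy. -/
def phiR (M : FGModuleCat.{u} Λ) : ℕ∞ :=
  stabIndex (inducedHom Inj (IsCosyzygy (Λ := Λ))) (addSpan Inj M)

variable (Λ)

/-- The `φ_l`-dimension of `Λ`. -/
def phiLDim : ℕ∞ := ⨆ M : FGModuleCat.{u} Λ, phiL M

/-- The `φ_r`-dimension of `Λ`. -/
def phiRDim : ℕ∞ := ⨆ M : FGModuleCat.{u} Λ, phiR M

end StableGroup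

/-! ### Strong idempotent ideals -/

section Ideals

variable {Λ : Type u} [Ring Λ]

lemma restrictScalars_exact {Γ : Type u} [Ring Γ] (f : Λ →+* Γ) :
    Limits.PreservesFiniteLimits (ModuleCat.restrictScalars.{u} f) ∧
      Limits.PreservesFiniteColimits (ModuleCat.restrictScalars.{u} f) :=
  ((Functor.exact_tfae (ModuleCat.restrictScalars.{u} f)).out 1 3).mp fun S h => by
    rw [ShortComplex.ShortExact.moduleCat_exact_iff_function_exact] at h ⊢
    exact h

instance {Γ : Type u} [Ring Γ] (f : Λ →+* Γ) :
    Limits.PreservesFiniteLimits (ModuleCat.restrictScalars.{u} f) :=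
  (restrictScalars_exact f).1

instance {Γ : Type u} [Ring Γ] (f : Λ →+* Γ) :
    Limits.PreservesFiniteColimits (ModuleCat.restrictScalars.{u} f) :=
  (restrictScalars_exact f).2

variable (A : Ideal Λ) [A.IsTwoSided]

/-- The inclusion functor from `Λ/A`-modules to `Λ`-modules. -/
abbrev incl : ModuleCat.{u} (Λ ⧸ A) ⥤ ModuleCat.{u} Λ :=
  ModuleCat.restrictScalars (Ideal.Quotient.mk A)

/-- `A` is a strong idempotent ideal: for all `X`, `Y` in `mod Λ/A` and all `i ≥ 0` the canonical map
`Ext^i_{Λ/A}(X, Y) → Ext^i_Λ(X, Y)` is bijective. (For `i = 1` this contains `A * A = A`.) -/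
def IsStrongIdempotent : Prop :=
  ∀ (X Y : FGModuleCat.{u} (Λ ⧸ A)) (i : ℕ),
    Function.Bijective ((incl A).mapExtAddHom X.obj Y.obj i)

lemma finite_inflate (X : ModuleCat.{u} (Λ ⧸ A)) (h : Module.Finite (Λ ⧸ A) X) :
    Module.Finite Λ ((incl A).obj X) := by
  let _ : Module (Λ ⧸ A) ((incl A).obj X) := X.isModule
  have : IsScalarTower Λ (Λ ⧸ A) ((incl A).obj X) :=
    ⟨fun a b x => mul_smul (Ideal.Quotient.mk A a) b (show X from x)⟩
  have : Module.Finite (Λ ⧸ A) ((incl A).obj X) := h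
  exact Module.Finite.trans (Λ ⧸ A) _

variable {A} in
/-- A finitely generated `Λ/A`-module, viewed in `mod Λ`. -/
def inflate (X : FGModuleCat.{u} (Λ ⧸ A)) : FGModuleCat.{u} Λ :=
  ⟨(incl A).obj X.obj, finite_inflate A X.obj X.property⟩

/-- `Λ/A` as a left `Λ`-module. -/
abbrev leftQuot : ModuleCat.{u} Λ := ModuleCat.of Λ (Λ ⧸ A)

/-- `Λ/A` as a right `Λ`-module, that is, as a left module over the opposite ring. -/
abbrev rightQuot : ModuleCat.{u} Λᵐᵒᵖ :=
  (ModuleCat.restrictScalars (RingHom.op (Ideal.Quotient.mk A))).obj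
    (ModuleCat.of (Λ ⧸ A)ᵐᵒᵖ (Λ ⧸ A))

end Ideals

/-! ### The endomorphisms induced by syzygies and cosyzygies are well defined -/

section WellDefined

variable {Λ : Type u} [Ring Λ] {Null : FGModuleCat.{u} Λ → Prop}

lemma cls_sum {A B C : FGModuleCat.{u} Λ} (e : C ≃ₗ[Λ] (A × B)) :
    cls Null C = cls Null A + cls Null B := by
  rw [← sub_eq_zero]
  exact (QuotientAddGroup.eq_zero_iff _).2 (AddSubgroup.subset_closure (StableRel.sum A B C e))

lemma cls_null {Z : FGModuleCat.{u} Λ} (h : Null Z) : cls Null Z = 0 :=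
  (QuotientAddGroup.eq_zero_iff _).2 (AddSubgroup.subset_closure (StableRel.null Z h))

lemma hom_ext_cls {ω ω' : StableK Null →+ StableK Null}
    (h : ∀ M, ω (cls Null M) = ω' (cls Null M)) : ω = ω' := by
  apply QuotientAddGroup.addMonoidHom_ext
  ext M
  exact h M

lemma existsUnique_isInduced (Syz : FGModuleCat.{u} Λ → FGModuleCat.{u} Λ → Prop)
    (ex : ∀ M, ∃ N, Syz M N)
    (uniq : ∀ M N N', Syz M N → Syz M N' → cls Null N = cls Null N')
    (sum : ∀ A B C A' B' : FGModuleCat.{u} Λ, Nonempty (C ≃ₗ[Λ] (A × B)) → Syz A A' → Syz B B' →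
      ∃ C', Syz C C' ∧ cls Null C' = cls Null A' + cls Null B')
    (null : ∀ Z, Null Z → ∃ N, Syz Z N ∧ cls Null N = 0) :
    ∃! ω, IsInduced Null Syz ω := by
  choose s hs using ex
  have hle : AddSubgroup.closure {x | StableRel Null x} ≤
      (FreeAbelianGroup.lift fun M => cls Null (s M)).ker := by
    rw [AddSubgroup.closure_le]
    rintro _ (⟨A, B, C, e⟩ | ⟨Z, hZ⟩)
    · obtain ⟨C', h1, h2⟩ := sum A B C _ _ ⟨e⟩ (hs A) (hs B)
      simp [AddMonoidHom.mem_ker, uniq _ _ _ (hs C) h1, h2]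
    · obtain ⟨N, h1, h2⟩ := null Z hZ
      simp [AddMonoidHom.mem_ker, uniq _ _ _ (hs Z) h1, h2]
  refine ⟨QuotientAddGroup.lift _ (FreeAbelianGroup.lift fun M => cls Null (s M)) hle, ?_, ?_⟩
  · intro M N h
    rw [← uniq _ _ _ (hs M) h]
    exact (QuotientAddGroup.lift_mk _ hle _).trans (FreeAbelianGroup.lift_apply_of _ _)
  · intro ω hω
    apply hom_ext_cls
    intro M
    rw [hω _ _ (hs M)]
    exact ((QuotientAddGroup.lift_mk _ hle _).trans (FreeAbelianGroup.lift_apply_of _ _)).symm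

/-- A split short exact sequence with projective cokernel. -/
lemma exists_equiv_of_projective {K L P : Type u} [AddCommGroup K] [AddCommGroup L] [AddCommGroup P]
    [Module Λ K] [Module Λ L] [Module Λ P] [Module.Projective Λ P] (f : K →ₗ[Λ] L) (g : L →ₗ[Λ] P)
    (hf : Function.Injective f) (hfg : Function.Exact f g) (hg : Function.Surjective g) :
    Nonempty (L ≃ₗ[Λ] (K × P)) := by
  obtain ⟨s, hs⟩ := Module.projective_lifting_property g LinearMap.id hg
  exact ⟨(hfg.splitSurjectiveEquiv hf ⟨s, hs⟩).1⟩

/-- A split short exact sequence with injective kernel. -/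
lemma exists_equiv_of_injective {I L C : Type u} [AddCommGroup I] [AddCommGroup L] [AddCommGroup C]
    [Module Λ I] [Module Λ L] [Module Λ C] [Module.Injective Λ I] (f : I →ₗ[Λ] L) (g : L →ₗ[Λ] C)
    (hf : Function.Injective f) (hfg : Function.Exact f g) (hg : Function.Surjective g) :
    Nonempty (L ≃ₗ[Λ] (I × C)) := by
  obtain ⟨s, hs⟩ := Module.Injective.extension_property Λ I I L f hf LinearMap.id
  exact ⟨(hfg.splitInjectiveEquiv hg ⟨s, hs⟩).1⟩

lemma isSyzygy_sum (A B C A' B' : FGModuleCat.{u} Λ) (e : C ≃ₗ[Λ] (A × B))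
    (hA : IsSyzygy A A') (hB : IsSyzygy B B') :
    IsSyzygy C (FGModuleCat.of Λ (A' × B')) := by
  obtain ⟨P, f, g, hP, hf, hfg, hg⟩ := hA
  obtain ⟨Q, f', g', hQ, hf', hfg', hg'⟩ := hB
  have : Module.Projective Λ P := hP
  have : Module.Projective Λ Q := hQ
  refine ⟨FGModuleCat.of Λ (P × Q), f.prodMap f', e.symm.toLinearMap ∘ₗ g.prodMap g',
    inferInstanceAs (Module.Projective Λ (P × Q)), hf.prodMap hf', ?_,
    e.symm.surjective.comp (hg.prodMap hg')⟩
  rintro ⟨x, y⟩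
  have h1 := hfg x
  have h2 := hfg' y
  constructor
  · intro h
    have h0 : (g x, g' y) = (0 : A × B) := e.symm.map_eq_zero_iff.1 h
    obtain ⟨a, ha⟩ := h1.1 (congrArg Prod.fst h0)
    obtain ⟨b, hb⟩ := h2.1 (congrArg Prod.snd h0)
    exact ⟨(a, b), Prod.ext ha hb⟩
  · rintro ⟨⟨a, b⟩, hab⟩
    refine e.symm.map_eq_zero_iff.2 (Prod.ext (h1.2 ⟨a, ?_⟩) (h2.2 ⟨b, ?_⟩))
    · exact congrArg Prod.fst hab
    · exact congrArg Prod.snd hab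

lemma isCosyzygy_sum (A B C A' B' : FGModuleCat.{u} Λ) (e : C ≃ₗ[Λ] (A × B))
    (hA : IsCosyzygy A A') (hB : IsCosyzygy B B') :
    IsCosyzygy C (FGModuleCat.of Λ (A' × B')) := by
  obtain ⟨P, f, g, hP, hf, hfg, hg⟩ := hA
  obtain ⟨Q, f', g', hQ, hf', hfg', hg'⟩ := hB
  have : Module.Injective Λ P := hP
  have : Module.Injective Λ Q := hQ
  have hPQ : Module.Injective Λ (P × Q) := by
    refine ⟨fun X Y _ _ _ _ i hi j => ?_⟩
    obtain ⟨a, ha⟩ := hP.out i hi (LinearMap.fst Λ P Q ∘ₗ j)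
    obtain ⟨b, hb⟩ := hQ.out i hi (LinearMap.snd Λ P Q ∘ₗ j)
    exact ⟨a.prod b, fun x => Prod.ext (ha x) (hb x)⟩
  refine ⟨FGModuleCat.of Λ (P × Q), f.prodMap f' ∘ₗ e.toLinearMap, g.prodMap g',
    hPQ, (hf.prodMap hf').comp e.injective, ?_, hg.prodMap hg'⟩
  rintro ⟨x, y⟩
  have h1 := hfg x
  have h2 := hfg' y
  constructor
  · intro h
    obtain ⟨a, ha⟩ := h1.1 (congrArg Prod.fst h)
    obtain ⟨b, hb⟩ := h2.1 (congrArg Prod.snd h)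
    refine ⟨e.symm (a, b), ?_⟩
    change (f.prodMap f') (e (e.symm (a, b))) = (x, y)
    rw [e.apply_symm_apply]
    exact Prod.ext ha hb
  · rintro ⟨c, hc⟩
    refine Prod.ext (h1.2 ⟨(e c).1, ?_⟩) (h2.2 ⟨(e c).2, ?_⟩)
    · exact congrArg Prod.fst hc
    · exact congrArg Prod.snd hc

/-- Schanuel's lemma. -/
lemma isSyzygy_unique (M N N' : FGModuleCat.{u} Λ) (h : IsSyzygy M N) (h' : IsSyzygy M N') :
    cls Proj N = cls Proj N' := by
  obtain ⟨P, f, g, hP, hf, hfg, hg⟩ := h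
  obtain ⟨Q, f', g', hQ, hf', hfg', hg'⟩ := h'
  have : Module.Projective Λ P := hP
  have : Module.Projective Λ Q := hQ
  let D : P × Q →ₗ[Λ] M := g.coprod (-g')
  have hD : ∀ p q, (p, q) ∈ D.ker ↔ g p = g' q := fun p q => by
    simp [D, ← sub_eq_add_neg, sub_eq_zero]
  obtain ⟨e₁⟩ : Nonempty (D.ker ≃ₗ[Λ] (N × Q)) := by
    refine exists_equiv_of_projective
      ((LinearMap.inl Λ P Q ∘ₗ f).codRestrict D.ker fun n => ?_)
      (LinearMap.snd Λ P Q ∘ₗ D.ker.subtype) ?_ ?_ ?_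
    · exact (hD _ _).2 (by simpa using hfg.apply_apply_eq_zero n)
    · intro a b hab
      exact hf (congrArg (fun z : D.ker => z.1.1) hab)
    · rintro ⟨⟨p, q⟩, hpq⟩
      have hpq' := (hD p q).1 hpq
      constructor
      · rintro (rfl : q = 0)
        obtain ⟨n, rfl⟩ := (hfg p).1 (by simpa using hpq')
        exact ⟨n, rfl⟩
      · rintro ⟨n, hn⟩
        exact (congrArg (fun z : D.ker => z.1.2) hn).symm
    · intro q
      obtain ⟨p, hp⟩ := hg (g' q)
      exact ⟨⟨(p, q), (hD _ _).2 hp⟩, rfl⟩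
  obtain ⟨e₂⟩ : Nonempty (D.ker ≃ₗ[Λ] (N' × P)) := by
    refine exists_equiv_of_projective
      ((LinearMap.inr Λ P Q ∘ₗ f').codRestrict D.ker fun n => ?_)
      (LinearMap.fst Λ P Q ∘ₗ D.ker.subtype) ?_ ?_ ?_
    · exact (hD _ _).2 (by simpa using (hfg'.apply_apply_eq_zero n).symm)
    · intro a b hab
      exact hf' (congrArg (fun z : D.ker => z.1.2) hab)
    · rintro ⟨⟨p, q⟩, hpq⟩
      have hpq' := (hD p q).1 hpq
      constructor
      · rintro (rfl : p = 0)
        obtain ⟨n, rfl⟩ := (hfg' q).1 (by simpa using hpq'.symm)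
        exact ⟨n, rfl⟩
      · rintro ⟨n, hn⟩
        exact (congrArg (fun z : D.ker => z.1.1) hn).symm
    · intro p
      obtain ⟨q, hq⟩ := hg' (g p)
      exact ⟨⟨(p, q), (hD _ _).2 hq.symm⟩, rfl⟩
  have k₁ := cls_sum (Null := Proj) (A := N) (B := Q) (C := FGModuleCat.of Λ (N × Q))
    (LinearEquiv.refl _ _)
  have k₂ := cls_sum (Null := Proj) (A := N') (B := P) (C := FGModuleCat.of Λ (N × Q))
    (e₁.symm.trans e₂)
  rw [cls_null hQ, add_zero] at k₁
  rw [cls_null hP, add_zero] at k₂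
  exact k₁.symm.trans k₂

/-- The dual of Schanuel's lemma. -/
lemma isCosyzygy_unique (M N N' : FGModuleCat.{u} Λ) (h : IsCosyzygy M N) (h' : IsCosyzygy M N') :
    cls Inj N = cls Inj N' := by
  obtain ⟨P, f, g, hP, hf, hfg, hg⟩ := h
  obtain ⟨Q, f', g', hQ, hf', hfg', hg'⟩ := h'
  have : Module.Injective Λ P := hP
  have : Module.Injective Λ Q := hQ
  let W : Submodule Λ (P × Q) := (f.prod f').range
  have hW : ∀ p q, (p, q) ∈ W ↔ ∃ m, f m = p ∧ f' m = q := fun p q => by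
    simp [W, LinearMap.mem_range]
  obtain ⟨e₁⟩ : Nonempty (((P × Q) ⧸ W) ≃ₗ[Λ] (Q × N)) := by
    refine exists_equiv_of_injective (W.mkQ ∘ₗ LinearMap.inr Λ P Q)
      (W.liftQ (g ∘ₗ LinearMap.fst Λ P Q) ?_) ?_ ?_ ?_
    · rintro ⟨p, q⟩ hpq
      obtain ⟨m, rfl, rfl⟩ := (hW p q).1 hpq
      simpa using hfg.apply_apply_eq_zero m
    · rw [← LinearMap.ker_eq_bot, LinearMap.ker_eq_bot']
      intro q hq
      obtain ⟨m, h1, h2⟩ := (hW 0 q).1 ((Submodule.Quotient.mk_eq_zero W).1 hq)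
      rw [hf (h1.trans (map_zero f).symm), map_zero] at h2
      exact h2.symm
    · intro z
      obtain ⟨⟨p, q⟩, rfl⟩ := W.mkQ_surjective z
      constructor
      · intro hz
        obtain ⟨m, rfl⟩ := (hfg p).1 hz
        refine ⟨q - f' m, (Submodule.Quotient.eq W).2 ((hW _ _).2 ⟨-m, ?_⟩)⟩
        simp
      · rintro ⟨q', hq'⟩
        rw [← hq']
        exact map_zero g
    · intro n
      obtain ⟨p, rfl⟩ := hg n
      exact ⟨W.mkQ (p, 0), rfl⟩
  obtain ⟨e₂⟩ : Nonempty (((P × Q) ⧸ W) ≃ₗ[Λ] (P × N')) := by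
    refine exists_equiv_of_injective (W.mkQ ∘ₗ LinearMap.inl Λ P Q)
      (W.liftQ (g' ∘ₗ LinearMap.snd Λ P Q) ?_) ?_ ?_ ?_
    · rintro ⟨p, q⟩ hpq
      obtain ⟨m, rfl, rfl⟩ := (hW p q).1 hpq
      simpa using hfg'.apply_apply_eq_zero m
    · rw [← LinearMap.ker_eq_bot, LinearMap.ker_eq_bot']
      intro p hp
      obtain ⟨m, h1, h2⟩ := (hW p 0).1 ((Submodule.Quotient.mk_eq_zero W).1 hp)
      rw [hf' (h2.trans (map_zero f').symm), map_zero] at h1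
      exact h1.symm
    · intro z
      obtain ⟨⟨p, q⟩, rfl⟩ := W.mkQ_surjective z
      constructor
      · intro hz
        obtain ⟨m, rfl⟩ := (hfg' q).1 hz
        refine ⟨p - f m, (Submodule.Quotient.eq W).2 ((hW _ _).2 ⟨-m, ?_⟩)⟩
        simp
      · rintro ⟨p', hp'⟩
        rw [← hp']
        exact map_zero g'
    · intro n
      obtain ⟨q, rfl⟩ := hg' n
      exact ⟨W.mkQ (0, q), rfl⟩
  have k₁ := cls_sum (Null := Inj) (A := Q) (B := N) (C := FGModuleCat.of Λ (Q × N))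
    (LinearEquiv.refl _ _)
  have k₂ := cls_sum (Null := Inj) (A := P) (B := N') (C := FGModuleCat.of Λ (Q × N))
    (e₁.symm.trans e₂)
  rw [cls_null hQ, zero_add] at k₁
  rw [cls_null hP, zero_add] at k₂
  exact k₁.symm.trans k₂

theorem existsUnique_isInduced_syzygy [IsNoetherianRing Λ] :
    ∃! ω, IsInduced Proj (IsSyzygy (Λ := Λ)) ω := by
  refine existsUnique_isInduced _ (fun M => ?_) isSyzygy_unique ?_ ?_
  · obtain ⟨n, g, hg⟩ := Module.Finite.exists_fin' Λ M
    exact ⟨FGModuleCat.of Λ g.ker, FGModuleCat.of Λ (Fin n → Λ), g.ker.subtype, g,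
      inferInstanceAs (Module.Projective Λ (Fin n → Λ)), g.ker.injective_subtype,
      LinearMap.exact_subtype_ker_map g, hg⟩
  · rintro A B C A' B' ⟨e⟩ hA hB
    exact ⟨_, isSyzygy_sum A B C A' B' e hA hB, cls_sum (LinearEquiv.refl _ _)⟩
  · intro Z hZ
    refine ⟨FGModuleCat.of Λ PUnit, ⟨Z, 0, LinearMap.id, hZ, ?_, ?_, fun x => ⟨x, rfl⟩⟩, ?_⟩
    · exact fun _ _ _ => rfl
    · intro x
      exact ⟨fun h => ⟨0, h.symm⟩, fun ⟨_, h⟩ => h.symm⟩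
    · exact cls_null (inferInstanceAs (Module.Projective Λ PUnit.{u + 1}))

theorem existsUnique_isInduced_cosyzygy_of_enough
    (ex : ∀ M : FGModuleCat.{u} Λ, ∃ (I : FGModuleCat.{u} Λ) (f : M →ₗ[Λ] I),
      Inj I ∧ Function.Injective f) :
    ∃! ω, IsInduced Inj (IsCosyzygy (Λ := Λ)) ω := by
  refine existsUnique_isInduced _ (fun M => ?_) isCosyzygy_unique ?_ ?_
  · obtain ⟨I, f, hI, hf⟩ := ex M
    exact ⟨FGModuleCat.of Λ (I ⧸ f.range), I, f, f.range.mkQ, hI, hf,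
      LinearMap.exact_map_mkQ_range f, f.range.mkQ_surjective⟩
  · rintro A B C A' B' ⟨e⟩ hA hB
    exact ⟨_, isCosyzygy_sum A B C A' B' e hA hB, cls_sum (LinearEquiv.refl _ _)⟩
  · intro Z hZ
    refine ⟨FGModuleCat.of Λ PUnit, ⟨Z, LinearMap.id, 0, hZ, fun _ _ h => h, ?_, ?_⟩, ?_⟩
    · intro x
      exact ⟨fun _ => ⟨x, rfl⟩, fun _ => rfl⟩
    · exact fun _ => ⟨0, rfl⟩
    · exact cls_null ⟨fun _ _ _ _ _ _ _ _ _ => ⟨0, fun _ => rfl⟩⟩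

/-- Over a left noetherian ring, `inducedHom Proj IsSyzygy` is the homomorphism `[M] ↦ [Ω M]`. -/
theorem isInduced_inducedHom_syzygy [IsNoetherianRing Λ] :
    IsInduced Proj (IsSyzygy (Λ := Λ)) (inducedHom Proj IsSyzygy) := by
  have h := (existsUnique_isInduced_syzygy (Λ := Λ)).exists
  rw [inducedHom, dif_pos h]
  exact h.choose_spec

end WellDefined

/-! ### Finitely generated injective modules over an artin algebra -/

section EnoughInjectives

variable {Λ : Type u} [Ring Λ]

/-- Every nonzero element of `N` has a nonzero multiple in `M`. -/
def EssOver {E : Type u} [AddCommGroup E] [Module Λ E] (M N : Submodule Λ E) : Prop :=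
  ∀ x ∈ N, x ≠ 0 → ∃ a : Λ, a • x ∈ M ∧ a • x ≠ 0

/-- Inside an injective module every submodule has an injective hull. -/
lemma exists_hull {E : Type u} [AddCommGroup E] [Module Λ E] [hE : Module.Injective Λ E]
    (M : Submodule Λ E) :
    ∃ N : Submodule Λ E, M ≤ N ∧ EssOver M N ∧ Module.Injective Λ N := by
  obtain ⟨N, hMN, hN⟩ := zorn_le_nonempty₀ {N : Submodule Λ E | EssOver M N} (by
    intro c hc hcc y hy
    refine ⟨sSup c, ?_, fun z hz => le_sSup hz⟩
    intro x hx hx0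
    obtain ⟨N, hNc, hxN⟩ := (Submodule.mem_sSup_of_directed ⟨y, hy⟩ hcc.directedOn).1 hx
    exact hc hNc x hxN hx0) M (fun x hx hx0 => ⟨1, by simpa using hx, by simpa using hx0⟩)
  obtain ⟨C, -, hC⟩ := zorn_le_nonempty₀ {C : Submodule Λ E | ∀ x ∈ C, x ∈ N → x = 0} (by
    intro c hc hcc y hy
    refine ⟨sSup c, ?_, fun z hz => le_sSup hz⟩
    intro x hx hxN
    obtain ⟨D, hDc, hxD⟩ := (Submodule.mem_sSup_of_directed ⟨y, hy⟩ hcc.directedOn).1 hx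
    exact hc hDc x hxD hxN) ⊥ (fun x hx _ => by simpa using hx)
  have hCN : ∀ x ∈ C, x ∈ N → x = 0 := hC.prop
  have hess : EssOver M N := hN.prop
  -- `N → E / C` is essential
  have key : ∀ e : E, e ∉ C → ∃ a : Λ, ∃ n ∈ N, n ≠ 0 ∧ C.mkQ (a • e) = C.mkQ n := by
    intro e he
    by_contra! hcon
    apply he
    have hmem : (C ⊔ Submodule.span Λ {e}) ∈ {C : Submodule Λ E | ∀ x ∈ C, x ∈ N → x = 0} := by
      intro x hx hxN
      obtain ⟨c, hc, z, hz, rfl⟩ := Submodule.mem_sup.1 hx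
      obtain ⟨a, rfl⟩ := Submodule.mem_span_singleton.1 hz
      by_contra h0
      refine hcon a _ hxN h0 ((Submodule.Quotient.eq C).2 ?_)
      simpa using hc
    exact hC.le_of_ge hmem le_sup_left
      (Submodule.mem_sup_right (Submodule.mem_span_singleton_self e))
  have hinj : Function.Injective (C.mkQ ∘ₗ N.subtype) := by
    rw [← LinearMap.ker_eq_bot, LinearMap.ker_eq_bot']
    intro x hx
    exact Subtype.ext (hCN x ((Submodule.Quotient.mk_eq_zero C).1 hx) x.2)
  obtain ⟨h, hh⟩ := hE.out (C.mkQ ∘ₗ N.subtype) hinj N.subtype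
  have hh' : ∀ n ∈ N, h (C.mkQ n) = n := fun n hn => hh ⟨n, hn⟩
  have hrange : h.range ∈ {N : Submodule Λ E | EssOver M N} := by
    rintro _ ⟨y, rfl⟩ hy0
    obtain ⟨e, rfl⟩ := C.mkQ_surjective y
    have he : e ∉ C := fun he => hy0 (by
      rw [show C.mkQ e = 0 from (Submodule.Quotient.mk_eq_zero C).2 he, map_zero])
    obtain ⟨a, n, hn, hn0, han⟩ := key e he
    obtain ⟨b, hb, hb0⟩ := hess n hn hn0
    have : (b * a) • h (C.mkQ e) = b • n := by
      rw [mul_smul, ← map_smul h, ← map_smul C.mkQ, han, hh' n hn]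
    exact ⟨b * a, this ▸ hb, this ▸ hb0⟩
  have hle : h.range ≤ N := hN.le_of_ge hrange fun n hn => ⟨_, hh' n hn⟩
  refine ⟨N, hMN, hess, ⟨fun X Y _ _ _ _ i hi j => ?_⟩⟩
  obtain ⟨k, hk⟩ := hE.out i hi (N.subtype ∘ₗ j)
  refine ⟨(h.codRestrict N fun y => hle ⟨y, rfl⟩) ∘ₗ C.mkQ ∘ₗ k, fun x => Subtype.ext ?_⟩
  change h (C.mkQ (k (i x))) = j x
  rw [hk x]
  exact hh' _ (j x).2

/-- An essential extension of a finitely generated module over an artin algebra is finitely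
generated. -/
lemma finite_of_essOver (R : Type v) [CommRing R] [IsArtinianRing R] [Algebra R Λ]
    [Module.Finite R Λ] {E : Type u} [AddCommGroup E] [Module Λ E] (M N : Submodule Λ E)
    (hM : M.FG) (hess : EssOver M N) : Module.Finite Λ N := by
  let _ : Module R E := Module.compHom E (algebraMap R Λ)
  have : IsScalarTower R Λ E := IsScalarTower.of_algebraMap_smul fun _ _ => rfl
  have : IsArtinianRing Λ := IsArtinianRing.of_finite R Λ
  have hsp : IsSemiprimaryRing Λ := inferInstance
  let J : Ideal Λ := Ring.jacobson Λ
  have hss : IsSemisimpleRing (Λ ⧸ J) := hsp.isSemisimpleRing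
  obtain ⟨n, hn⟩ : IsNilpotent J := hsp.isNilpotent
  have : Module.Finite Λ M := Module.Finite.of_fg hM
  have : Module.Finite R M := Module.Finite.trans Λ M
  have hMn : IsNoetherian R M := inferInstance
  have h1 : ∀ T : Submodule Λ E, T ≤ N → (∀ a ∈ J, ∀ x ∈ T, a • x = 0) → T ≤ M := by
    intro T hTN hT
    have htor : Module.IsTorsionBySet Λ T J := fun x a => Subtype.ext (hT a a.2 x x.2)
    let _ := htor.module
    have : IsSemisimpleModule Λ T := htor.isSemisimpleModule_iff.1 inferInstance
    obtain ⟨D, hD⟩ := exists_isCompl (M.comap T.subtype)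
    have hD0 : D = ⊥ := by
      rw [eq_bot_iff]
      intro x hx
      by_contra hx0
      obtain ⟨a, ha, ha0⟩ := hess x (hTN x.2) fun h => hx0 (by
        rw [Submodule.mem_bot]; exact Subtype.ext h)
      have := Submodule.disjoint_def.1 hD.disjoint (a • x) ha (D.smul_mem a hx)
      exact ha0 (congrArg Subtype.val this)
    have := hD.sup_eq_top
    rw [hD0, sup_bot_eq] at this
    intro x hx
    have h : (⟨x, hx⟩ : T) ∈ M.comap T.subtype := this ▸ Submodule.mem_top
    exact h
  obtain ⟨m, g, hg⟩ : ∃ (m : ℕ) (g : Fin m → Λ),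
      Submodule.span R (Set.range g) = J.restrictScalars R :=
    Submodule.fg_iff_exists_fin_generating_family.1 (IsNoetherian.noetherian _)
  have hgJ : ∀ k, g k ∈ J := fun k => by
    have : g k ∈ J.restrictScalars R := hg ▸ Submodule.subset_span ⟨k, rfl⟩
    exact this
  have h2 : ∀ (k : ℕ) (T : Submodule Λ E), T ≤ N → (∀ a ∈ J ^ k, ∀ x ∈ T, a • x = 0) →
      IsNoetherian R T := by
    intro k
    induction k with
    | zero =>
      intro T _ hT
      have : Subsingleton T := ⟨fun x y => Subtype.ext (by
        have hx := hT 1 (by rw [Submodule.pow_zero, Ideal.one_eq_top]; exact Submodule.mem_top) x x.2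
        have hy := hT 1 (by rw [Submodule.pow_zero, Ideal.one_eq_top]; exact Submodule.mem_top) y y.2
        rw [one_smul] at hx hy
        rw [hx, hy])⟩
      infer_instance
    | succ k ih =>
      intro T hTN hT
      let T' : Submodule Λ E := J • T
      have hT'T : T' ≤ T := Submodule.smul_le_right
      have hT' : IsNoetherian R T' := by
        refine ih T' (hT'T.trans hTN) fun a ha x hx => ?_
        have hx' : x ∈ J • T := hx
        refine Submodule.smul_induction_on (p := fun x => a • x = 0) hx' ?_ ?_
        · intro r hr y hy
          rw [smul_smul]
          exact hT _ (by rw [Submodule.pow_succ]; exact Ideal.mul_mem_mul ha hr) y hy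
        · intro y z hy hz
          rw [smul_add, hy, hz, add_zero]
      let F : T →ₗ[R] (Fin m → T') :=
        { toFun := fun x i => ⟨g i • (x : E), Submodule.smul_mem_smul (hgJ i) x.2⟩
          map_add' := fun x y => by
            funext i; exact Subtype.ext (smul_add _ _ _)
          map_smul' := fun r x => by
            funext i; exact Subtype.ext (smul_algebra_smul_comm r (g i) (x : E)) }
      have hker : ∀ x : T, F x = 0 → (x : E) ∈ M := by
        intro x hx
        have hgx : ∀ i, g i • (x : E) = 0 := fun i => congrArg Subtype.val (congrFun hx i)
        have hJx : ∀ a ∈ J, a • (x : E) = 0 := by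
          intro a ha
          have ha' : a ∈ Submodule.span R (Set.range g) := by rw [hg]; exact ha
          clear ha
          induction ha' using Submodule.span_induction with
          | mem a h => obtain ⟨i, rfl⟩ := h; exact hgx i
          | zero => exact zero_smul _ _
          | add a b _ _ h1 h2 => rw [add_smul, h1, h2, add_zero]
          | smul r a _ h => rw [smul_assoc, h, smul_zero]
        refine h1 (Submodule.span Λ {(x : E)}) ?_ ?_ (Submodule.mem_span_singleton_self _)
        · rw [Submodule.span_singleton_le_iff_mem]; exact hTN x.2
        · intro a ha y hy
          obtain ⟨b, rfl⟩ := Submodule.mem_span_singleton.1 hy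
          rw [smul_smul]
          exact hJx _ (Ideal.mul_mem_right b J ha)
      have hkn : IsNoetherian R F.ker := by
        let G : F.ker →ₗ[R] M :=
          { toFun := fun x => ⟨(x : T), hker x x.2⟩
            map_add' := fun _ _ => rfl
            map_smul' := fun _ _ => rfl }
        exact isNoetherian_of_injective G fun x y h =>
          Subtype.ext (Subtype.ext (congrArg (fun z : M => (z : E)) h))
      exact isNoetherian_of_range_eq_ker F.ker.subtype F (by simp)
  have := h2 n N le_rfl fun a ha x _ => by
    rw [hn] at ha
    rw [show a = 0 from ha, zero_smul]
  have : Module.Finite R N := inferInstance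
  exact Module.Finite.of_restrictScalars_finite R Λ N

theorem existsUnique_isInduced_cosyzygy (R : Type v) [CommRing R] [IsArtinianRing R] [Algebra R Λ]
    [Module.Finite R Λ] : ∃! ω, IsInduced Inj (IsCosyzygy (Λ := Λ)) ω := by
  refine existsUnique_isInduced_cosyzygy_of_enough fun M => ?_
  have := ModuleCat.enoughInjectives.{u, u} Λ
  obtain ⟨⟨E, hE, i, hi⟩⟩ := EnoughInjectives.presentation M.obj
  have hE' : Module.Injective Λ E := (Module.injective_iff_injective_object Λ E).2 hE
  have hi' : Function.Injective i.hom := (ModuleCat.mono_iff_injective i).1 hi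
  obtain ⟨N, hMN, hess, hN⟩ := exists_hull i.hom.range
  have hfin := finite_of_essOver R i.hom.range N
    (by rw [← Submodule.map_top]; exact Module.Finite.fg_top.map _) hess
  exact ⟨FGModuleCat.of Λ N, i.hom.codRestrict N fun x => hMN ⟨x, rfl⟩, hN,
    fun x y h => hi' (congrArg Subtype.val h)⟩

/-- Over an artin algebra, `inducedHom Inj IsCosyzygy` is the homomorphism `[M] ↦ [Ω⁻¹ M]`. -/
theorem isInduced_inducedHom_cosyzygy (R : Type v) [CommRing R] [IsArtinianRing R] [Algebra R Λ]
    [Module.Finite R Λ] : IsInduced Inj (IsCosyzygy (Λ := Λ)) (inducedHom Inj IsCosyzygy) := by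
  have h := (existsUnique_isInduced_cosyzygy (Λ := Λ) R).exists
  rw [inducedHom, dif_pos h]
  exact h.choose_spec

end EnoughInjectives

end

end IgusaTodorov

/-! Write `ω` and `ω'` for the syzygy operators on the stable groups of `Λ` and `Λ/A`, and let `n`
bound the projective dimension of the left module `Λ/A`. Two homomorphisms link the stable groups:
`t`, induced by `M ↦ M / A M`, and `i`, sending `[X]` to `ω^n [X]` with `X` inflated to `Λ`.

Strong idempotence controls `t`. An inflated module has no higher extensions over `Λ` by injective
`Λ/A`-modules, since there are none over `Λ/A`. This property, a substitute for the vanishing of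
`Tor_i(Λ/A, M)`, passes to syzygies, and it keeps `0 → N → P → M → 0` exact after reduction modulo
`A` (`IsSyzygy.reflect`). Hence `t (ω^s [X]) = ω'^s [X]` (`stableReflect_iterate`).

Finite projective dimension controls `i`. Projective `Λ/A`-modules have projective dimension at most
`n` over `Λ`, so `ω^n` kills them and `i` is well defined. If the middle term of a short exact
sequence has projective dimension at most `n`, the left term is the syzygy of the right one after
`n` further syzygies (`IsInduced.iterate_succ_cls_eq`); hence `i ω' = ω i`.

Now let `x` lie in `⟨add X⟩` over `Λ/A` with `ω'^(s+1) x = 0`, and lift `x` to `y` in the span of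
the inflated summands. Applying `i` gives `ω^(n+s+1) y = 0`. If `ω` is injective on all images from
step `s` on, then `ω^s y = 0`, and applying `t` gives `ω'^s x = 0` (`stabIndex_le_stabIndex`).

The dual argument replaces `M / A M` by `{x | A x = 0}`, that is `Hom(Λ/A, M)`, and uses the
vanishing of `Ext^i(Λ/A, M)` for `i > 0`. Injective `Λ/A`-modules are summands of finite powers of
the character dual of `Λ/A`, and character duals turn projective dimension on the right into
injective dimension on the left. -/

namespace IgusaTodorov

noncomputable section

/-! ### Homomorphisms out of the stable group -/

section Lift

variable {Λ : Type u} [Ring Λ] {Null : FGModuleCat.{u} Λ → Prop} {G : Type*} [AddCommGroup G]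

/-- The homomorphism out of the stable group given by a function on modules that is additive on
direct sums and vanishes on the null class. -/
def stableLift (F : FGModuleCat.{u} Λ → G)
    (hsum : ∀ A B C : FGModuleCat.{u} Λ, (C ≃ₗ[Λ] (A × B)) → F C = F A + F B)
    (hnull : ∀ Z, Null Z → F Z = 0) : StableK Null →+ G :=
  QuotientAddGroup.lift _ (FreeAbelianGroup.lift F) <| by
    rw [AddSubgroup.closure_le]
    rintro _ (⟨A, B, C, e⟩ | ⟨Z, hZ⟩)
    · simp [AddMonoidHom.mem_ker, hsum A B C e]
    · simp [AddMonoidHom.mem_ker, hnull Z hZ]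

lemma stableLift_cls (F : FGModuleCat.{u} Λ → G)
    (hsum : ∀ A B C : FGModuleCat.{u} Λ, (C ≃ₗ[Λ] (A × B)) → F C = F A + F B)
    (hnull : ∀ Z, Null Z → F Z = 0) (M : FGModuleCat.{u} Λ) :
    stableLift F hsum hnull (cls Null M) = F M :=
  (QuotientAddGroup.lift_mk _ _ _).trans (FreeAbelianGroup.lift_apply_of _ _)

/-- Comparison of the stabilization indices of two endomorphisms along a correspondence of
subgroups which both homomorphisms `t` and `i` respect. -/
lemma stabIndex_le_stabIndex {K K' : Type*} [AddCommGroup K] [AddCommGroup K'] {ω : K →+ K}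
    {ω' : K' →+ K'} {H : AddSubgroup K} {H' : AddSubgroup K'} (t : K →+ K') (i : K' →+ K) (N : ℕ)
    (h : ∀ x ∈ H', ∃ y ∈ H, ∀ s, t (ω^[s] y) = ω'^[s] x ∧ i (ω'^[s] x) = ω^[N + s] y) :
    stabIndex ω' H' ≤ stabIndex ω H := by
  refine le_iInf₂ fun n hn => iInf₂_le n fun s hs => ⟨?_, ?_, ?_⟩
  · rintro _ ⟨x, hx, rfl⟩
    exact ⟨x, hx, Function.iterate_succ_apply' _ _ _⟩
  -- Only injectivity has content. The difference of two elements with equal images is lifted to `z`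
  -- on the `ω` side.
  · rintro _ ⟨x, hx, rfl⟩ _ ⟨y, hy, rfl⟩ hxy
    rw [← Function.iterate_succ_apply' ω', ← Function.iterate_succ_apply' ω', ← sub_eq_zero,
      ← iterate_map_sub] at hxy
    rw [← sub_eq_zero, ← iterate_map_sub]
    obtain ⟨z, hz, hzs⟩ := h (x - y) (H'.sub_mem hx hy)
    -- Injectivity of `ω` on each of the images `ω^(s+k)(H)` cancels one `ω` at a time.
    have hdesc : ∀ k, ω^[s + k] z = 0 → ω^[s] z = 0 := by
      intro k
      induction k with
      | zero => exact id
      | succ k ih =>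
        intro h0
        refine ih ((hn (s + k) (by omega)).injOn ⟨z, hz, rfl⟩
          ⟨0, H.zero_mem, iterate_map_zero ω _⟩ ?_)
        rw [← Function.iterate_succ_apply' ω, map_zero]
        exact h0
    have hN : ω^[s + (N + 1)] z = 0 := by
      have := (hzs (s + 1)).2
      rw [hxy, map_zero] at this
      rw [show s + (N + 1) = N + (s + 1) by omega, ← this]
    rw [← (hzs s).1, hdesc _ hN, map_zero]
  · rintro _ ⟨x, hx, rfl⟩
    exact ⟨_, ⟨x, hx, rfl⟩, (Function.iterate_succ_apply' _ _ _).symm⟩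

end Lift

/-! ### Inflation of modules and linear maps -/

section Inflate

variable {Λ : Type u} [Ring Λ] {A : Ideal Λ} [A.IsTwoSided]

/-- A `Λ/A`-linear map, viewed as a `Λ`-linear map. -/
def inflateHom {X Y : FGModuleCat.{u} (Λ ⧸ A)} (f : X →ₗ[Λ ⧸ A] Y) : inflate X →ₗ[Λ] inflate Y :=
  ((incl A).map (ModuleCat.ofHom f)).hom

/-- A `Λ/A`-linear equivalence onto a product, viewed as a `Λ`-linear equivalence. -/
def inflateProdEquiv {X Y Z : FGModuleCat.{u} (Λ ⧸ A)} (e : Z ≃ₗ[Λ ⧸ A] (X × Y)) :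
    inflate Z ≃ₗ[Λ] (inflate X × inflate Y) where
  toFun z := e z
  invFun p := e.symm p
  map_add' x y := e.map_add x y
  map_smul' a x := e.map_smul (Ideal.Quotient.mk A a) x
  left_inv x := e.left_inv x
  right_inv x := e.right_inv x

lemma IsSummand.inflate {X Y : FGModuleCat.{u} (Λ ⧸ A)} (h : IsSummand X Y) :
    IsSummand (inflate X) (inflate Y) := by
  obtain ⟨L, ⟨e⟩⟩ := h
  exact ⟨IgusaTodorov.inflate L, ⟨inflateProdEquiv e⟩⟩

/-- A submodule of an inflated module, viewed as a `Λ/A`-submodule. -/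
def deflateSubmodule {X : FGModuleCat.{u} (Λ ⧸ A)} (p : Submodule Λ (inflate X)) :
    Submodule (Λ ⧸ A) X where
  carrier := {x | (show inflate X from x) ∈ p}
  add_mem' := p.add_mem
  zero_mem' := p.zero_mem
  smul_mem' b x hx := by
    obtain ⟨a, rfl⟩ := Ideal.Quotient.mk_surjective b
    exact p.smul_mem a hx

/-- As `Λ → Λ/A` is surjective, both rings give the same submodules and so the same decompositions.
Generators of `addSpan` therefore inflate to generators. -/
lemma IsIndecomposable.inflate {X : FGModuleCat.{u} (Λ ⧸ A)} (h : IsIndecomposable X) :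
    IsIndecomposable (inflate X) := by
  refine ⟨h.1, fun p q hpq => ?_⟩
  have hc : IsCompl (deflateSubmodule p) (deflateSubmodule q) := by
    refine ⟨Submodule.disjoint_def.2 fun x hx hx' =>
      Submodule.disjoint_def.1 hpq.disjoint x hx hx', codisjoint_iff.2 ?_⟩
    rw [eq_top_iff]
    intro x _
    have hx : (show IgusaTodorov.inflate X from x) ∈ p ⊔ q := by
      rw [hpq.sup_eq_top]; exact Submodule.mem_top
    obtain ⟨y, hy, z, hz, hyz⟩ := Submodule.mem_sup.1 hx
    exact Submodule.mem_sup.2 ⟨y, hy, z, hz, hyz⟩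
  refine (h.2 _ _ hc).imp (fun h0 => ?_) fun h0 => ?_
  all_goals
    rw [eq_bot_iff] at h0 ⊢
    exact fun x hx => h0 hx

/-- Comparison of the Igusa-Todorov functions of a module and its inflation. -/
lemma stabIndex_addSpan_le {Null : FGModuleCat.{u} Λ → Prop}
    {Null' : FGModuleCat.{u} (Λ ⧸ A) → Prop} {ω : StableK Null →+ StableK Null}
    {ω' : StableK Null' →+ StableK Null'} (t : StableK Null →+ StableK Null')
    (i : StableK Null' →+ StableK Null) (N : ℕ)
    (ht : ∀ (X : FGModuleCat.{u} (Λ ⧸ A)) (s : ℕ),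
      t (ω^[s] (cls Null (inflate X))) = ω'^[s] (cls Null' X))
    (hi : ∀ X : FGModuleCat.{u} (Λ ⧸ A), i (cls Null' X) = ω^[N] (cls Null (inflate X)))
    (hcomm : ∀ x, i (ω' x) = ω (i x)) (X : FGModuleCat.{u} (Λ ⧸ A)) :
    stabIndex ω' (addSpan Null' X) ≤ stabIndex ω (addSpan Null (inflate X)) := by
  have hcomm' : ∀ s x, i (ω'^[s] x) = ω^[s] (i x) := fun s x =>
    (Function.Semiconj.iterate_right (f := i) (ga := ω') (gb := ω) hcomm s) x
  refine stabIndex_le_stabIndex t i N fun x hx => ?_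
  -- The lift `y` is built generator by generator. The rule `[Y] ↦ [inflate Y]` need not be a
  -- homomorphism of stable groups, because inflation need not preserve the null class.
  refine AddSubgroup.closure_induction (p := fun x _ => ∃ y ∈ addSpan Null (inflate X),
    ∀ s, t (ω^[s] y) = ω'^[s] x ∧ i (ω'^[s] x) = ω^[N + s] y) ?_ ?_ ?_ ?_ hx
  · rintro _ ⟨Y, hY, hYX, rfl⟩
    refine ⟨cls Null (inflate Y), AddSubgroup.subset_closure ⟨_, hY.inflate, hYX.inflate, rfl⟩,
      fun s => ⟨ht Y s, ?_⟩⟩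
    rw [hcomm', hi, ← Function.iterate_add_apply, add_comm]
  · exact ⟨0, zero_mem _, fun s => by simp [iterate_map_zero]⟩
  · rintro x y _ _ ⟨x', hx', hxs⟩ ⟨y', hy', hys⟩
    refine ⟨x' + y', add_mem hx' hy', fun s => ?_⟩
    simp only [iterate_map_add, map_add, (hxs s).1, (hys s).1, (hxs s).2, (hys s).2, and_self]
  · rintro x _ ⟨x', hx', hxs⟩
    refine ⟨-x', neg_mem hx', fun s => ?_⟩
    simp only [iterate_map_neg, map_neg, (hxs s).1, (hxs s).2, and_self]

end Inflate

/-! ### Generalities on modules, short exact sequences and the stable group -/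

section General

variable {Λ : Type u} [Ring Λ]

/-- Isomorphism invariance is not among the defining relations; it follows from the sum relation
with a zero summand. -/
lemma cls_congr {Null : FGModuleCat.{u} Λ → Prop} {M N : FGModuleCat.{u} Λ} (e : M ≃ₗ[Λ] N) :
    cls Null M = cls Null N := by
  have h₁ := cls_sum (Null := Null) (A := N) (B := FGModuleCat.of Λ PUnit.{u + 1}) (C := M)
    (e.trans LinearEquiv.prodUnique.symm)
  have h₂ := cls_sum (Null := Null) (A := N) (B := FGModuleCat.of Λ PUnit.{u + 1}) (C := N)
    LinearEquiv.prodUnique.symm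
  exact h₁.trans h₂.symm

lemma shortExact_moduleCatMk {L E M : Type u} [AddCommGroup L] [AddCommGroup E] [AddCommGroup M]
    [Module Λ L] [Module Λ E] [Module Λ M] {f : L →ₗ[Λ] E} {g : E →ₗ[Λ] M}
    (hf : Function.Injective f) (hfg : Function.Exact f g) (hg : Function.Surjective g) :
    (ShortComplex.moduleCatMk f g hfg.linearMap_comp_eq_zero).ShortExact :=
  ModuleCat.shortComplex_shortExact _ hfg hf hg

/-- A linear map with a left inverse exhibits a retract in the category of modules. -/
def retractOfLinearMap {X Y : ModuleCat.{u} Λ} (s : X →ₗ[Λ] Y) (g : Y →ₗ[Λ] X)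
    (h : ∀ x, g (s x) = x) : Retract X Y where
  i := ModuleCat.ofHom s
  r := ModuleCat.ofHom g
  retract := ModuleCat.hom_ext (LinearMap.ext h)

/-- The sequence `M → M^(n+1) → M^n` forgets the zeroth coordinate. Dimension bounds for finite
powers follow by induction along it. -/
lemma exact_single_funLeft (M : Type u) [AddCommGroup M] [Module Λ M] (n : ℕ) :
    Function.Exact (LinearMap.single Λ (fun _ : Fin (n + 1) => M) 0)
      (LinearMap.funLeft Λ M (Fin.succ : Fin n → Fin (n + 1))) := by
  intro x
  constructor
  · intro hx
    refine ⟨x 0, funext fun j => ?_⟩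
    induction j using Fin.cases with
    | zero => simp
    | succ j => simpa using (congrFun hx j).symm
  · rintro ⟨y, rfl⟩
    ext j
    simp [LinearMap.funLeft_apply]

lemma surjective_funLeft_succ (M : Type u) [AddCommGroup M] [Module Λ M] (n : ℕ) :
    Function.Surjective (LinearMap.funLeft Λ M (Fin.succ : Fin n → Fin (n + 1))) :=
  LinearMap.funLeft_surjective_of_injective Λ M _ (Fin.succ_injective n)

lemma hasProjectiveDimensionLT_fin {M : Type u} [AddCommGroup M] [Module Λ M] {d : ℕ}
    (h : HasProjectiveDimensionLT (ModuleCat.of Λ M) d) (n : ℕ) :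
    HasProjectiveDimensionLT (ModuleCat.of Λ (Fin n → M)) d := by
  induction n with
  | zero =>
    have := (ModuleCat.isZero_of_subsingleton
      (ModuleCat.of Λ (Fin 0 → M))).hasProjectiveDimensionLT_zero
    exact hasProjectiveDimensionLT_of_ge _ 0 d (Nat.zero_le d)
  | succ n ih =>
    exact (shortExact_moduleCatMk (Pi.single_injective (M := fun _ => M) (0 : Fin (n + 1)))
      (exact_single_funLeft M n) (surjective_funLeft_succ M n)).hasProjectiveDimensionLT_X₂ d h ih

lemma exists_isSyzygy [IsNoetherianRing Λ] (M : FGModuleCat.{u} Λ) :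
    ∃ N : FGModuleCat.{u} Λ, IsSyzygy M N := by
  obtain ⟨n, g, hg⟩ := Module.Finite.exists_fin' Λ M
  exact ⟨FGModuleCat.of Λ g.ker, FGModuleCat.of Λ (Fin n → Λ), g.ker.subtype, g,
    inferInstanceAs (Module.Projective Λ (Fin n → Λ)), g.ker.injective_subtype,
    LinearMap.exact_subtype_ker_map g, hg⟩

/-- The horseshoe lemma for a single step of a projective resolution. -/
lemma exists_isSyzygy_exact [IsNoetherianRing Λ] {L E M : FGModuleCat.{u} Λ} {f : L →ₗ[Λ] E}
    {g : E →ₗ[Λ] M} (hf : Function.Injective f) (hfg : Function.Exact f g)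
    (hg : Function.Surjective g) :
    ∃ (L' E' M' : FGModuleCat.{u} Λ) (f' : L' →ₗ[Λ] E') (g' : E' →ₗ[Λ] M'),
      IsSyzygy L L' ∧ IsSyzygy E E' ∧ IsSyzygy M M' ∧
      Function.Injective f' ∧ Function.Exact f' g' ∧ Function.Surjective g' := by
  obtain ⟨a, p, hp⟩ := Module.Finite.exists_fin' Λ L
  obtain ⟨b, q, hq⟩ := Module.Finite.exists_fin' Λ M
  obtain ⟨r, hr⟩ := Module.projective_lifting_property g q hg
  have hr' : ∀ y, g (r y) = q y := fun y => LinearMap.congr_fun hr y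
  have hgf : ∀ x, g (f x) = 0 := hfg.apply_apply_eq_zero
  -- The horseshoe map: `p` on the first summand, and on the second the lift `r` of `q` through `g`.
  let c : ((Fin a → Λ) × (Fin b → Λ)) →ₗ[Λ] E := (f ∘ₗ p).coprod r
  have hc : ∀ x y, c (x, y) = f (p x) + r y := fun x y => rfl
  have hcs : Function.Surjective c := by
    intro e
    obtain ⟨y, hy⟩ := hq (g e)
    obtain ⟨l, hl⟩ := (hfg (e - r y)).1 (by rw [map_sub, hr', hy, sub_self])
    obtain ⟨x, rfl⟩ := hp l
    exact ⟨(x, y), by rw [hc, hl, sub_add_cancel]⟩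
  refine ⟨FGModuleCat.of Λ p.ker, FGModuleCat.of Λ c.ker, FGModuleCat.of Λ q.ker,
    (LinearMap.inl Λ _ _).restrict fun x hx => ?_,
    (LinearMap.snd Λ _ _).restrict fun x hx => ?_,
    ⟨FGModuleCat.of Λ (Fin a → Λ), p.ker.subtype, p,
      inferInstanceAs (Module.Projective Λ (Fin a → Λ)), p.ker.injective_subtype,
      LinearMap.exact_subtype_ker_map p, hp⟩,
    ⟨FGModuleCat.of Λ ((Fin a → Λ) × (Fin b → Λ)), c.ker.subtype, c,
      inferInstanceAs (Module.Projective Λ ((Fin a → Λ) × (Fin b → Λ))), c.ker.injective_subtype,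
      LinearMap.exact_subtype_ker_map c, hcs⟩,
    ⟨FGModuleCat.of Λ (Fin b → Λ), q.ker.subtype, q,
      inferInstanceAs (Module.Projective Λ (Fin b → Λ)), q.ker.injective_subtype,
      LinearMap.exact_subtype_ker_map q, hq⟩, ?_, ?_, ?_⟩
  · rw [LinearMap.mem_ker] at hx ⊢
    rw [LinearMap.inl_apply, hc, hx, map_zero, map_zero, add_zero]
  · obtain ⟨x, y⟩ := x
    rw [LinearMap.mem_ker, hc] at hx
    rw [LinearMap.mem_ker, LinearMap.snd_apply, ← hr']
    have := congrArg g hx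
    rwa [map_add, hgf, zero_add, map_zero] at this
  · intro x y hxy
    exact Subtype.ext (congrArg (fun z : c.ker => z.1.1) hxy)
  · rintro ⟨⟨x, y⟩, hxy⟩
    constructor
    · intro h0
      have hy : y = 0 := congrArg Subtype.val h0
      subst hy
      rw [LinearMap.mem_ker, hc, map_zero, add_zero] at hxy
      exact ⟨⟨x, hf (hxy.trans (map_zero f).symm)⟩, rfl⟩
    · rintro ⟨z, hz⟩
      exact Subtype.ext (congrArg (fun z : c.ker => z.1.2) hz).symm
  · rintro ⟨y, hy⟩
    -- For `y` in the kernel of `q`, the element `r y` comes from `L`, so a correction in the first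
    -- summand moves `(0, y)` into the kernel of `c`.
    obtain ⟨l, hl⟩ := (hfg (-r y)).1 (by rw [map_neg, hr', LinearMap.mem_ker.1 hy, neg_zero])
    obtain ⟨x, rfl⟩ := hp l
    exact ⟨⟨(x, y), by rw [LinearMap.mem_ker, hc, hl, neg_add_cancel]⟩, rfl⟩

lemma IsSyzygy.hasProjectiveDimensionLT {M N : FGModuleCat.{u} Λ} (h : IsSyzygy M N) {n : ℕ}
    (hM : HasProjectiveDimensionLT M.obj (n + 2)) : HasProjectiveDimensionLT N.obj (n + 1) := by
  obtain ⟨P, f, g, hP, hf, hfg, hg⟩ := h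
  have hP' : Projective P.obj := (IsProjective.iff_projective (R := Λ) P).1 hP
  exact (shortExact_moduleCatMk hf hfg hg).hasProjectiveDimensionLT_X₁ _
    (hasProjectiveDimensionLT_of_ge P.obj 1 (n + 1) (by omega)) hM

section

variable {ω : StableK (Proj (Λ := Λ)) →+ StableK (Proj (Λ := Λ))} (hω : IsInduced Proj IsSyzygy ω)

include hω

/-- The `n`-th syzygy of a module of projective dimension at most `n` is projective. -/
lemma IsInduced.iterate_cls_eq_zero [IsNoetherianRing Λ] {n : ℕ} {M : FGModuleCat.{u} Λ}
    (hM : HasProjectiveDimensionLT M.obj (n + 1)) : ω^[n] (cls Proj M) = 0 := by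
  induction n generalizing M with
  | zero =>
    exact cls_null ((IsProjective.iff_projective (R := Λ) M).2
      (projective_iff_hasProjectiveDimensionLT_one.2 hM))
  | succ n ih =>
    obtain ⟨N, hN⟩ := exists_isSyzygy M
    rw [Function.iterate_succ_apply, hω M N hN]
    exact ih (hN.hasProjectiveDimensionLT hM)

/-- If `E` is projective, `L` is a syzygy of `M`. Otherwise the horseshoe lemma replaces the
sequence by one of syzygies and lowers the bound on `E` by one. This is what makes inflation
followed by `ω^n` commute with syzygies. -/
lemma IsInduced.iterate_succ_cls_eq [IsNoetherianRing Λ] {n : ℕ} {L E M : FGModuleCat.{u} Λ}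
    {f : L →ₗ[Λ] E} {g : E →ₗ[Λ] M} (hf : Function.Injective f) (hfg : Function.Exact f g)
    (hg : Function.Surjective g) (hE : HasProjectiveDimensionLT E.obj (n + 1)) :
    ω^[n + 1] (cls Proj M) = ω^[n] (cls Proj L) := by
  induction n generalizing L E M with
  | zero =>
    exact hω M L ⟨E, f, g, (IsProjective.iff_projective (R := Λ) E).2
      (projective_iff_hasProjectiveDimensionLT_one.2 hE), hf, hfg, hg⟩
  | succ n ih =>
    obtain ⟨L', E', M', f', g', hL, hE', hM, hf', hfg', hg'⟩ := exists_isSyzygy_exact hf hfg hg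
    rw [Function.iterate_succ_apply, Function.iterate_succ_apply ω n (cls Proj L), hω _ _ hM,
      hω _ _ hL]
    exact ih hf' hfg' hg' (hE'.hasProjectiveDimensionLT hE)

end

end General

/-! ### The reflection `M ↦ M / A M` -/

section Reflect

variable {Λ : Type u} [Ring Λ] (A : Ideal Λ) [A.IsTwoSided]

/-- The `Λ/A`-module `M / A M`. -/
def reflect (M : FGModuleCat.{u} Λ) : FGModuleCat.{u} (Λ ⧸ A) :=
  letI := (Module.isTorsionBySet_quotient_ideal_smul M A).module
  haveI : IsScalarTower Λ (Λ ⧸ A) (M ⧸ A • (⊤ : Submodule Λ M)) :=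
    (Module.isTorsionBySet_quotient_ideal_smul M A).isScalarTower
  haveI : Module.Finite (Λ ⧸ A) (M ⧸ A • (⊤ : Submodule Λ M)) :=
    Module.Finite.of_restrictScalars_finite Λ _ _
  FGModuleCat.of (Λ ⧸ A) (M ⧸ A • (⊤ : Submodule Λ M))

/-- The projection onto `M / A M`. -/
def reflectMk (M : FGModuleCat.{u} Λ) : M →+ reflect A M :=
  (A • (⊤ : Submodule Λ M)).mkQ.toAddMonoidHom

lemma reflectMk_smul {M : FGModuleCat.{u} Λ} (a : Λ) (x : M) :
    reflectMk A M (a • x) = Ideal.Quotient.mk A a • reflectMk A M x := rfl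

lemma reflectMk_surjective (M : FGModuleCat.{u} Λ) : Function.Surjective (reflectMk A M) :=
  (A • (⊤ : Submodule Λ M)).mkQ_surjective

lemma reflectMk_eq_zero_iff {M : FGModuleCat.{u} Λ} {x : M} :
    reflectMk A M x = 0 ↔ x ∈ A • (⊤ : Submodule Λ M) :=
  Submodule.Quotient.mk_eq_zero _

/-- A `Λ/A`-linear map out of `M / A M` is a `Λ`-linear map out of `M`. -/
lemma exists_reflect_lift {M : FGModuleCat.{u} Λ} {Y : Type u} [AddCommGroup Y] [Module (Λ ⧸ A) Y]
    (φ : M →+ Y) (hφ : ∀ (a : Λ) (x : M), φ (a • x) = Ideal.Quotient.mk A a • φ x) :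
    ∃ ψ : reflect A M →ₗ[Λ ⧸ A] Y, ∀ x, ψ (reflectMk A M x) = φ x := by
  let _ : Module Λ Y := Module.compHom Y (Ideal.Quotient.mk A)
  let φ' : M →ₗ[Λ] Y := { φ with map_smul' := hφ }
  -- Elements of `A` act as zero on the `Λ/A`-module `Y`.
  have hle : A • (⊤ : Submodule Λ M) ≤ φ'.ker := by
    rw [Submodule.smul_le]
    intro a ha x _
    rw [LinearMap.mem_ker]
    change φ (a • x) = 0
    rw [hφ, Ideal.Quotient.eq_zero_iff_mem.2 ha, zero_smul]
  let χ := (A • (⊤ : Submodule Λ M)).liftQ φ' hle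
  refine ⟨{ toFun := χ, map_add' := χ.map_add, map_smul' := fun b x => ?_ }, fun x => rfl⟩
  obtain ⟨a, rfl⟩ := Ideal.Quotient.mk_surjective b
  exact χ.map_smul a x

variable {A} in
lemma reflect_hom_ext {M : FGModuleCat.{u} Λ} {Y : Type u} [AddCommGroup Y] [Module (Λ ⧸ A) Y]
    {φ ψ : reflect A M →ₗ[Λ ⧸ A] Y} (h : ∀ x, φ (reflectMk A M x) = ψ (reflectMk A M x)) :
    φ = ψ := by
  ext x
  obtain ⟨x, rfl⟩ := reflectMk_surjective A M x
  exact h x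

/-- The map `M / A M → N / A N` induced by a linear map. -/
def reflectMap {M N : FGModuleCat.{u} Λ} (f : M →ₗ[Λ] N) : reflect A M →ₗ[Λ ⧸ A] reflect A N :=
  (exists_reflect_lift A (Y := reflect A N) ((reflectMk A N).comp f.toAddMonoidHom)
    fun a x => by simp [reflectMk_smul]).choose

@[simp]
lemma reflectMap_mk {M N : FGModuleCat.{u} Λ} (f : M →ₗ[Λ] N) (x : M) :
    reflectMap A f (reflectMk A M x) = reflectMk A N (f x) :=
  (exists_reflect_lift A (Y := reflect A N) ((reflectMk A N).comp f.toAddMonoidHom)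
    fun a x => by simp [reflectMk_smul]).choose_spec x

/-- The reflection is additive. -/
def reflectProdEquiv {L M N : FGModuleCat.{u} Λ} (e : N ≃ₗ[Λ] (L × M)) :
    reflect A N ≃ₗ[Λ ⧸ A] (reflect A L × reflect A M) :=
  LinearEquiv.ofLinearMap
    ((reflectMap A (LinearMap.fst Λ L M ∘ₗ e.toLinearMap)).prod
      (reflectMap A (LinearMap.snd Λ L M ∘ₗ e.toLinearMap)))
    ((reflectMap A (e.symm.toLinearMap ∘ₗ LinearMap.inl Λ L M)).coprod
      (reflectMap A (e.symm.toLinearMap ∘ₗ LinearMap.inr Λ L M)))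
    (LinearMap.prod_ext (reflect_hom_ext fun x => by simp) (reflect_hom_ext fun x => by simp))
    (reflect_hom_ext fun x => by simp [← map_add])

/-- Reflection is left adjoint to inflation, which preserves surjections: a lifting problem over
`Λ/A` is solved over `Λ`, and the solution factors through `P / A P`. -/
lemma projective_reflect {P : FGModuleCat.{u} Λ} (hP : Proj P) : Proj (reflect A P) := by
  refine Module.Projective.of_lifting_property fun {X Y} _ _ _ _ f g hf => ?_
  let _ : Module Λ X := Module.compHom X (Ideal.Quotient.mk A)
  let _ : Module Λ Y := Module.compHom Y (Ideal.Quotient.mk A)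
  let f' : X →ₗ[Λ] Y := { f with map_smul' := fun a x => f.map_smul (Ideal.Quotient.mk A a) x }
  let g' : P →ₗ[Λ] Y :=
    { toFun := fun x => g (reflectMk A P x)
      map_add' := fun x y => by rw [map_add, map_add]
      map_smul' := fun a x => by rw [reflectMk_smul, map_smul]; rfl }
  have : Module.Projective Λ P := hP
  obtain ⟨h, hh⟩ := Module.projective_lifting_property f' g' hf
  obtain ⟨k, hk⟩ := exists_reflect_lift A h.toAddMonoidHom h.map_smul
  refine ⟨k, reflect_hom_ext fun x => ?_⟩
  rw [LinearMap.comp_apply, hk]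
  exact LinearMap.congr_fun hh x

/-- A `Λ/A`-module is its own reflection. -/
lemma cls_reflect_inflate {Null : FGModuleCat.{u} (Λ ⧸ A) → Prop} (X : FGModuleCat.{u} (Λ ⧸ A)) :
    cls Null (reflect A (inflate X)) = cls Null X := by
  obtain ⟨ψ, hψ⟩ := exists_reflect_lift A (M := inflate X) (Y := X) (AddMonoidHom.id X)
    fun _ _ => rfl
  refine cls_congr (LinearEquiv.ofBijective ψ ⟨?_, fun x => ⟨_, hψ x⟩⟩)
  rw [← LinearMap.ker_eq_bot, LinearMap.ker_eq_bot']
  intro y hy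
  obtain ⟨x, rfl⟩ := reflectMk_surjective A _ y
  rw [hψ] at hy
  exact (congrArg (reflectMk A (inflate X)) hy).trans (map_zero _)

end Reflect

/-! ### The comparison for syzygies -/

section Left

variable {Λ : Type u} [Ring Λ] (A : Ideal Λ) [A.IsTwoSided]

/-- All higher extensions of `M` by finitely generated injective `Λ/A`-modules vanish. -/
def ExtInjVanish (M : FGModuleCat.{u} Λ) : Prop :=
  ∀ I : FGModuleCat.{u} (Λ ⧸ A), Inj I → ∀ (i : ℕ) (e : Abelian.Ext M.obj (inflate I).obj (i + 1)),
    e = 0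

variable {A}

/-- Every such extension over `Λ` comes from one over `Λ/A`, and there the second argument is
injective. -/
lemma IsStrongIdempotent.extInjVanish (hA : IsStrongIdempotent A) (X : FGModuleCat.{u} (Λ ⧸ A)) :
    ExtInjVanish A (inflate X) := by
  intro I hI i e
  have : Injective I.obj := (Module.injective_iff_injective_object (Λ ⧸ A) I).1 hI
  obtain ⟨e', rfl⟩ := (hA X I (i + 1)).2 e
  rw [Abelian.Ext.eq_zero_of_injective e']
  exact map_zero _

/-- Dimension shift: a class in degree `i + 1` on `N` has its connecting image in degree `i + 2` on
`M`, which is zero, so it comes from the projective `P`. -/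
lemma ExtInjVanish.syzygy {M N : FGModuleCat.{u} Λ} (hM : ExtInjVanish A M) (h : IsSyzygy M N) :
    ExtInjVanish A N := by
  intro I hI i e
  obtain ⟨P, f, g, hP, hf, hfg, hg⟩ := h
  have hP' : Projective P.obj := (IsProjective.iff_projective (R := Λ) P).1 hP
  obtain ⟨x, rfl⟩ := Abelian.Ext.contravariant_sequence_exact₁
    (shortExact_moduleCatMk hf hfg hg) (inflate I).obj e (add_comm 1 (i + 1)) (hM I hI _ _)
  have hx : x = 0 := Abelian.Ext.eq_zero_of_projective (P := P.obj) x
  rw [hx, Abelian.Ext.comp_zero]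
  rfl

/-- The obstruction to extending `φ` lies in `Ext^1` of `M` by the inflation of `I`. -/
lemma ExtInjVanish.exists_extension {N P M : FGModuleCat.{u} Λ} (hM : ExtInjVanish A M)
    {f : N →ₗ[Λ] P} {g : P →ₗ[Λ] M} (hf : Function.Injective f) (hfg : Function.Exact f g)
    (hg : Function.Surjective g) {I : FGModuleCat.{u} (Λ ⧸ A)} (hI : Inj I)
    (φ : N →ₗ[Λ] inflate I) : ∃ ψ : P →ₗ[Λ] inflate I, ψ ∘ₗ f = φ := by
  let φ' : N.obj ⟶ (inflate I).obj := ConcreteCategory.ofHom φ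
  obtain ⟨x, hx⟩ := Abelian.Ext.contravariant_sequence_exact₁
    (shortExact_moduleCatMk hf hfg hg) (inflate I).obj (Abelian.Ext.mk₀ φ') (add_comm 1 0) (hM I hI _ _)
  obtain ⟨ψ, rfl⟩ := Abelian.Ext.homEquiv₀.symm.surjective x
  refine ⟨ψ.hom, ?_⟩
  rw [Abelian.Ext.homEquiv₀_symm_apply, Abelian.Ext.mk₀_comp_mk₀] at hx
  exact congrArg ModuleCat.Hom.hom ((Abelian.Ext.mk₀_bijective _ _).1 hx)

/-- Over an artin algebra every finitely generated module embeds into a finitely generated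
injective module. -/
lemma exists_injective_embedding (R : Type v) [CommRing R] [IsArtinianRing R] [Algebra R Λ]
    [Module.Finite R Λ] (M : FGModuleCat.{u} Λ) :
    ∃ (I : FGModuleCat.{u} Λ) (f : M →ₗ[Λ] I), Inj I ∧ Function.Injective f := by
  have := ModuleCat.enoughInjectives.{u, u} Λ
  obtain ⟨⟨E, hE, i, hi⟩⟩ := EnoughInjectives.presentation M.obj
  have hE' : Module.Injective Λ E := (Module.injective_iff_injective_object Λ E).2 hE
  have hi' : Function.Injective i.hom := (ModuleCat.mono_iff_injective i).1 hi
  obtain ⟨N, hMN, hess, hN⟩ := exists_hull i.hom.range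
  have hfin := finite_of_essOver R i.hom.range N
    (by rw [← Submodule.map_top]; exact Module.Finite.fg_top.map _) hess
  exact ⟨FGModuleCat.of Λ N, i.hom.codRestrict N fun x => hMN ⟨x, rfl⟩, hN,
    fun x y h => hi' (congrArg Subtype.val h)⟩

/-- Reflection is right exact in any case; the hypothesis on `M` is needed only for injectivity of
`N / A N → P / A P`. Embed `N / A N` in an injective `Λ/A`-module `I`. The composite `N → I` extends
to `P` and then factors through `P / A P`, so whatever dies in `P / A P` dies in `I`. -/
lemma IsSyzygy.reflect (R : Type v) [CommRing R] [IsArtinianRing R] [Algebra R Λ]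
    [Module.Finite R Λ] {M N : FGModuleCat.{u} Λ} (hM : ExtInjVanish A M) (h : IsSyzygy M N) :
    IsSyzygy (reflect A M) (reflect A N) := by
  obtain ⟨P, f, g, hP, hf, hfg, hg⟩ := h
  have hgf : ∀ x, g (f x) = 0 := hfg.apply_apply_eq_zero
  refine ⟨IgusaTodorov.reflect A P, reflectMap A f, reflectMap A g, projective_reflect A hP,
    ?_, ?_, ?_⟩
  · obtain ⟨I, j, hI, hj⟩ := exists_injective_embedding (Λ := Λ ⧸ A) R (IgusaTodorov.reflect A N)
    let φ : N →ₗ[Λ] inflate I :=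
      { toFun := fun x => j (reflectMk A N x)
        map_add' := fun x y => by rw [map_add, map_add]; rfl
        map_smul' := fun a x => by rw [reflectMk_smul, map_smul]; rfl }
    obtain ⟨ψ, hψ⟩ := hM.exists_extension hf hfg hg hI φ
    obtain ⟨χ, hχ⟩ := exists_reflect_lift A (M := P) (Y := I) ψ.toAddMonoidHom ψ.map_smul
    rw [← LinearMap.ker_eq_bot, LinearMap.ker_eq_bot']
    intro y hy
    obtain ⟨x, rfl⟩ := reflectMk_surjective A N y
    refine hj ((LinearMap.congr_fun hψ x).symm.trans ?_)
    have := congrArg χ hy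
    rw [reflectMap_mk, hχ, map_zero] at this
    exact this.trans (map_zero j).symm
  · intro y
    obtain ⟨x, rfl⟩ := reflectMk_surjective A P y
    constructor
    · intro hx
      rw [reflectMap_mk, reflectMk_eq_zero_iff] at hx
      -- Since `A M` is the image of `A P`, an element of `P` sent into `A M` can be corrected by an
      -- element of `A P` to lie in the kernel of `g`.
      have htop : A • (⊤ : Submodule Λ M) = (A • (⊤ : Submodule Λ P)).map g := by
        rw [Submodule.map_smul'', Submodule.map_top, LinearMap.range_eq_top.2 hg]
      rw [htop] at hx
      obtain ⟨z, hz, hzx⟩ := hx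
      obtain ⟨n, hn⟩ := (hfg (x - z)).1 (by rw [map_sub, hzx, sub_self])
      refine ⟨reflectMk A N n, ?_⟩
      rw [reflectMap_mk, hn, map_sub, (reflectMk_eq_zero_iff A).2 hz, sub_zero]
    · rintro ⟨z, hz⟩
      obtain ⟨n, rfl⟩ := reflectMk_surjective A N z
      rw [← hz, reflectMap_mk, reflectMap_mk, hgf, map_zero]
  · intro y
    obtain ⟨x, rfl⟩ := reflectMk_surjective A M y
    obtain ⟨p, rfl⟩ := hg x
    exact ⟨reflectMk A P p, reflectMap_mk A g p⟩

/-- The homomorphism of stable groups induced by the reflection. -/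
def stableReflect (A : Ideal Λ) [A.IsTwoSided] :
    StableK (Proj (Λ := Λ)) →+ StableK (Proj (Λ := Λ ⧸ A)) :=
  stableLift (fun M => cls Proj (reflect A M)) (fun _ _ _ e => cls_sum (reflectProdEquiv A e))
    fun _ hZ => cls_null (projective_reflect A hZ)

/-- Reflection is compatible with syzygies only under `ExtInjVanish`, so the induction varies `M`
and carries this condition along the syzygies. -/
lemma stableReflect_iterate (R : Type v) [CommRing R] [IsArtinianRing R] [Algebra R Λ]
    [Module.Finite R Λ] {ω : StableK (Proj (Λ := Λ)) →+ StableK (Proj (Λ := Λ))}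
    {ω' : StableK (Proj (Λ := Λ ⧸ A)) →+ StableK (Proj (Λ := Λ ⧸ A))}
    (hω : IsInduced Proj IsSyzygy ω) (hω' : IsInduced Proj IsSyzygy ω') (s : ℕ)
    {M : FGModuleCat.{u} Λ} (hM : ExtInjVanish A M) :
    stableReflect A (ω^[s] (cls Proj M)) = ω'^[s] (cls Proj (reflect A M)) := by
  have : IsArtinianRing Λ := IsArtinianRing.of_finite R Λ
  induction s generalizing M with
  | zero => exact stableLift_cls _ _ _ M
  | succ s ih =>
    obtain ⟨N, hN⟩ := exists_isSyzygy M
    rw [Function.iterate_succ_apply, Function.iterate_succ_apply, hω M N hN, ih (hM.syzygy hN),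
      hω' _ _ (hN.reflect R hM)]

/-- A finitely generated projective is a retract of some `(Λ/A)^m`, and inflation preserves
retracts. -/
lemma hasProjectiveDimensionLT_inflate {n : ℕ} (hn : HasProjectiveDimensionLT (leftQuot A) n)
    {P : FGModuleCat.{u} (Λ ⧸ A)} (hP : Proj P) :
    HasProjectiveDimensionLT (inflate P).obj n := by
  obtain ⟨m, g, hg⟩ := Module.Finite.exists_fin' (Λ ⧸ A) P
  have : Module.Projective (Λ ⧸ A) P := hP
  obtain ⟨s, hs⟩ := Module.projective_lifting_property g LinearMap.id hg
  let s' : inflate P →ₗ[Λ] (Fin m → Λ ⧸ A) :=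
    { toFun := s
      map_add' := s.map_add
      map_smul' := fun a x => s.map_smul (Ideal.Quotient.mk A a) x }
  let g' : (Fin m → Λ ⧸ A) →ₗ[Λ] inflate P :=
    { toFun := g
      map_add' := g.map_add
      map_smul' := fun a x => g.map_smul (Ideal.Quotient.mk A a) x }
  have hr : Retract (inflate P).obj (ModuleCat.of Λ (Fin m → Λ ⧸ A)) :=
    retractOfLinearMap (X := (inflate P).obj) s' g' (LinearMap.congr_fun hs)
  have := hasProjectiveDimensionLT_fin hn m
  exact hr.hasProjectiveDimensionLT n

theorem phiL_le_phiL_inflate (R : Type v) [CommRing R] [IsArtinianRing R] [Algebra R Λ]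
    [Module.Finite R Λ] (hA : IsStrongIdempotent A) (hpd : projectiveDimension (leftQuot A) < ⊤)
    (X : FGModuleCat.{u} (Λ ⧸ A)) : phiL X ≤ phiL (inflate X) := by
  have : IsArtinianRing Λ := IsArtinianRing.of_finite R Λ
  have : IsArtinianRing (Λ ⧸ A) := IsArtinianRing.of_finite R (Λ ⧸ A)
  obtain ⟨n, hn⟩ := (projectiveDimension_ne_top_iff _).1 hpd.ne
  have hω := isInduced_inducedHom_syzygy (Λ := Λ)
  have hω' := isInduced_inducedHom_syzygy (Λ := Λ ⧸ A)
  -- The `n` syzygies after inflation kill the projective `Λ/A`-modules; inflation alone need not.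
  let i : StableK (Proj (Λ := Λ ⧸ A)) →+ StableK (Proj (Λ := Λ)) :=
    stableLift (fun X => (inducedHom Proj IsSyzygy)^[n] (cls Proj (inflate X)))
      (fun _ _ _ e => by rw [cls_sum (inflateProdEquiv e), iterate_map_add])
      fun _ hZ => hω.iterate_cls_eq_zero (hasProjectiveDimensionLT_inflate hn hZ)
  have hi : ∀ X, i (cls Proj X) = (inducedHom Proj IsSyzygy)^[n] (cls Proj (inflate X)) :=
    stableLift_cls _ _ _
  have hcomm : i.comp (inducedHom Proj IsSyzygy) = (inducedHom Proj IsSyzygy).comp i := by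
    apply QuotientAddGroup.addMonoidHom_ext
    ext M
    change i (inducedHom Proj IsSyzygy (cls Proj M)) = inducedHom Proj IsSyzygy (i (cls Proj M))
    obtain ⟨N, hN⟩ := exists_isSyzygy M
    rw [hω' M N hN, hi, hi, ← Function.iterate_succ_apply' (inducedHom Proj IsSyzygy)]
    obtain ⟨P, f, g, hP, hf, hfg, hg⟩ := hN
    exact (hω.iterate_succ_cls_eq (f := inflateHom f) (g := inflateHom g) hf hfg hg
      (hasProjectiveDimensionLT_inflate hn hP)).symm
  refine stabIndex_addSpan_le (stableReflect A) i n (fun X s => ?_) hi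
    (fun x => DFunLike.congr_fun hcomm x) X
  rw [stableReflect_iterate R hω hω' s (hA.extInjVanish X), cls_reflect_inflate]

end Left

/-! ### Injective dimension and cosyzygies -/

section CosyzygyGeneral

variable {Λ : Type u} [Ring Λ]

lemma hasInjectiveDimensionLT_fin {M : Type u} [AddCommGroup M] [Module Λ M] {d : ℕ}
    (h : HasInjectiveDimensionLT (ModuleCat.of Λ M) d) (n : ℕ) :
    HasInjectiveDimensionLT (ModuleCat.of Λ (Fin n → M)) d := by
  induction n with
  | zero =>
    have := (ModuleCat.isZero_of_subsingleton
      (ModuleCat.of Λ (Fin 0 → M))).hasInjectiveDimensionLT_zero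
    exact hasInjectiveDimensionLT_of_ge _ 0 d (Nat.zero_le d)
  | succ n ih =>
    exact (shortExact_moduleCatMk (Pi.single_injective (M := fun _ => M) (0 : Fin (n + 1)))
      (exact_single_funLeft M n) (surjective_funLeft_succ M n)).hasInjectiveDimensionLT_X₂ d h ih

lemma inj_prod {I J : FGModuleCat.{u} Λ} (hI : Inj I) (hJ : Inj J) :
    Inj (FGModuleCat.of Λ (I × J)) := by
  refine ⟨fun X Y _ _ _ _ i hi j => ?_⟩
  obtain ⟨a, ha⟩ := hI.out i hi (LinearMap.fst Λ I J ∘ₗ j)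
  obtain ⟨b, hb⟩ := hJ.out i hi (LinearMap.snd Λ I J ∘ₗ j)
  exact ⟨a.prod b, fun x => Prod.ext (ha x) (hb x)⟩

lemma isCosyzygy_quotient_range {M I : FGModuleCat.{u} Λ} (hI : Inj I) {f : M →ₗ[Λ] I}
    (hf : Function.Injective f) : IsCosyzygy M (FGModuleCat.of Λ (I ⧸ f.range)) :=
  ⟨I, f, f.range.mkQ, hI, hf, LinearMap.exact_map_mkQ_range f, f.range.mkQ_surjective⟩

lemma exists_isCosyzygy (R : Type v) [CommRing R] [IsArtinianRing R] [Algebra R Λ]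
    [Module.Finite R Λ] (M : FGModuleCat.{u} Λ) : ∃ N : FGModuleCat.{u} Λ, IsCosyzygy M N := by
  obtain ⟨I, f, hI, hf⟩ := exists_injective_embedding R M
  exact ⟨_, isCosyzygy_quotient_range hI hf⟩

/-- The horseshoe lemma for a single step of an injective resolution. -/
lemma exists_isCosyzygy_exact (R : Type v) [CommRing R] [IsArtinianRing R] [Algebra R Λ]
    [Module.Finite R Λ] {L E M : FGModuleCat.{u} Λ} {f : L →ₗ[Λ] E}
    {g : E →ₗ[Λ] M} (hf : Function.Injective f) (hfg : Function.Exact f g)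
    (hg : Function.Surjective g) :
    ∃ (L' E' M' : FGModuleCat.{u} Λ) (f' : L' →ₗ[Λ] E') (g' : E' →ₗ[Λ] M'),
      IsCosyzygy L L' ∧ IsCosyzygy E E' ∧ IsCosyzygy M M' ∧
      Function.Injective f' ∧ Function.Exact f' g' ∧ Function.Surjective g' := by
  obtain ⟨I, p, hI, hp⟩ := exists_injective_embedding R L
  obtain ⟨J, q, hJ, hq⟩ := exists_injective_embedding R M
  -- `r` extends `p` from `L` to `E`; paired with `q ∘ g` it embeds `E` in `I × J`.
  obtain ⟨r, hr⟩ := hI.out f hf p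
  have hgf : ∀ x, g (f x) = 0 := hfg.apply_apply_eq_zero
  let c : E →ₗ[Λ] FGModuleCat.of Λ (I × J) := r.prod (q ∘ₗ g)
  have hc : Function.Injective c := by
    rw [← LinearMap.ker_eq_bot, LinearMap.ker_eq_bot']
    intro e he
    have h1 : r e = 0 := congrArg Prod.fst he
    have h2 : q (g e) = 0 := congrArg Prod.snd he
    obtain ⟨l, rfl⟩ := (hfg e).1 (hq (h2.trans (map_zero q).symm))
    rw [hr] at h1
    rw [hp (h1.trans (map_zero p).symm), map_zero]
  refine ⟨_, _, _, p.range.mapQ c.range (LinearMap.inl Λ I J) ?_,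
    c.range.mapQ q.range (LinearMap.snd Λ I J) ?_, isCosyzygy_quotient_range hI hp,
    isCosyzygy_quotient_range (inj_prod hI hJ) hc, isCosyzygy_quotient_range hJ hq, ?_, ?_, ?_⟩
  · rintro _ ⟨l, rfl⟩
    refine ⟨f l, Prod.ext (hr l) ?_⟩
    change q (g (f l)) = 0
    rw [hgf, map_zero]
  · rintro _ ⟨e, rfl⟩
    exact ⟨g e, rfl⟩
  · rw [← LinearMap.ker_eq_bot, LinearMap.ker_eq_bot']
    intro z hz
    obtain ⟨x, rfl⟩ := p.range.mkQ_surjective z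
    obtain ⟨e, he⟩ := (Submodule.Quotient.mk_eq_zero _).1 hz
    have h1 : r e = x := congrArg Prod.fst he
    have h2 : q (g e) = 0 := congrArg Prod.snd he
    obtain ⟨l, rfl⟩ := (hfg e).1 (hq (h2.trans (map_zero q).symm))
    exact (Submodule.Quotient.mk_eq_zero _).2 ⟨l, (hr l).symm.trans h1⟩
  · intro z
    obtain ⟨⟨x, y⟩, rfl⟩ := c.range.mkQ_surjective z
    constructor
    · intro hz
      obtain ⟨m, hm⟩ := (Submodule.Quotient.mk_eq_zero _).1 hz
      obtain ⟨e, rfl⟩ := hg m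
      have hm' : q (g e) = y := hm
      refine ⟨p.range.mkQ (x - r e), (Submodule.Quotient.eq c.range).2 ⟨-e, Prod.ext ?_ ?_⟩⟩
      · change r (-e) = (x - r e) - x
        rw [map_neg]; abel
      · change q (g (-e)) = 0 - y
        rw [map_neg, map_neg, hm', zero_sub]
    · rintro ⟨w, hw⟩
      obtain ⟨x', rfl⟩ := p.range.mkQ_surjective w
      rw [← hw]
      exact (Submodule.Quotient.mk_eq_zero _).2 (zero_mem _)
  · intro z
    obtain ⟨y, rfl⟩ := q.range.mkQ_surjective z
    exact ⟨c.range.mkQ (0, y), rfl⟩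

lemma inj_iff_hasInjectiveDimensionLT_one (I : FGModuleCat.{u} Λ) :
    Inj I ↔ HasInjectiveDimensionLT I.obj 1 :=
  (Module.injective_iff_injective_object Λ I).trans injective_iff_hasInjectiveDimensionLT_one

lemma IsCosyzygy.hasInjectiveDimensionLT {M N : FGModuleCat.{u} Λ} (h : IsCosyzygy M N) {n : ℕ}
    (hM : HasInjectiveDimensionLT M.obj (n + 2)) : HasInjectiveDimensionLT N.obj (n + 1) := by
  obtain ⟨I, f, g, hI, hf, hfg, hg⟩ := h
  have := (inj_iff_hasInjectiveDimensionLT_one I).1 hI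
  exact (shortExact_moduleCatMk hf hfg hg).hasInjectiveDimensionLT_X₃ _
    (hasInjectiveDimensionLT_of_ge I.obj 1 (n + 1) (by omega)) hM

section

variable (R : Type v) [CommRing R] [IsArtinianRing R] [Algebra R Λ] [Module.Finite R Λ]
  {ω : StableK (Inj (Λ := Λ)) →+ StableK (Inj (Λ := Λ))} (hω : IsInduced Inj IsCosyzygy ω)

include R hω

lemma iterate_cosyzygy_cls_eq_zero {n : ℕ} {M : FGModuleCat.{u} Λ}
    (hM : HasInjectiveDimensionLT M.obj (n + 1)) : ω^[n] (cls Inj M) = 0 := by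
  induction n generalizing M with
  | zero => exact cls_null ((inj_iff_hasInjectiveDimensionLT_one M).2 hM)
  | succ n ih =>
    obtain ⟨N, hN⟩ := exists_isCosyzygy R M
    rw [Function.iterate_succ_apply, hω M N hN]
    exact ih (hN.hasInjectiveDimensionLT hM)

/-- Dual to `IsInduced.iterate_succ_cls_eq`, with the outer terms exchanged: for injective `E`, `M`
is a cosyzygy of `L`, and the horseshoe step lowers the injective dimension of `E`. -/
lemma iterate_succ_cosyzygy_cls_eq {n : ℕ} {L E M : FGModuleCat.{u} Λ}
    {f : L →ₗ[Λ] E} {g : E →ₗ[Λ] M} (hf : Function.Injective f) (hfg : Function.Exact f g)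
    (hg : Function.Surjective g) (hE : HasInjectiveDimensionLT E.obj (n + 1)) :
    ω^[n + 1] (cls Inj L) = ω^[n] (cls Inj M) := by
  induction n generalizing L E M with
  | zero => exact hω L M ⟨E, f, g, (inj_iff_hasInjectiveDimensionLT_one E).2 hE, hf, hfg, hg⟩
  | succ n ih =>
    obtain ⟨L', E', M', f', g', hL, hE', hM, hf', hfg', hg'⟩ :=
      exists_isCosyzygy_exact R hf hfg hg
    rw [Function.iterate_succ_apply, Function.iterate_succ_apply ω n (cls Inj M), hω _ _ hM,
      hω _ _ hL]
    exact ih hf' hfg' hg' (hE'.hasInjectiveDimensionLT hE)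

end

end CosyzygyGeneral

/-! ### The coreflection `M ↦ {x | A x = 0}` -/

section Coreflect

variable {Λ : Type u} [Ring Λ] (A : Ideal Λ) [A.IsTwoSided]

/-- The submodule of all elements killed by `A`. -/
def annSubmodule (M : Type u) [AddCommGroup M] [Module Λ M] : Submodule Λ M where
  carrier := {x | ∀ a ∈ A, a • x = 0}
  add_mem' hx hy a ha := by rw [smul_add, hx a ha, hy a ha, add_zero]
  zero_mem' a _ := smul_zero a
  smul_mem' b x hx a ha := by
    rw [smul_smul]
    exact hx _ (A.mul_mem_right b ha)

lemma isTorsionBySet_annSubmodule (M : Type u) [AddCommGroup M] [Module Λ M] :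
    Module.IsTorsionBySet Λ (annSubmodule A M) A :=
  fun x a => Subtype.ext (x.2 a a.2)

variable [IsNoetherianRing Λ]

/-- The `Λ/A`-module of all elements of `M` killed by `A`. -/
def coreflect (M : FGModuleCat.{u} Λ) : FGModuleCat.{u} (Λ ⧸ A) :=
  letI := (isTorsionBySet_annSubmodule A M).module
  haveI : IsScalarTower Λ (Λ ⧸ A) (annSubmodule A M) :=
    (isTorsionBySet_annSubmodule A M).isScalarTower
  haveI : Module.Finite (Λ ⧸ A) (annSubmodule A M) :=
    Module.Finite.of_restrictScalars_finite Λ _ _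
  FGModuleCat.of (Λ ⧸ A) (annSubmodule A M)

/-- The inclusion of the elements killed by `A`. -/
def coreflectIncl (M : FGModuleCat.{u} Λ) : coreflect A M →+ M :=
  (annSubmodule A M).subtype.toAddMonoidHom

lemma coreflectIncl_smul {M : FGModuleCat.{u} Λ} (a : Λ) (x : coreflect A M) :
    coreflectIncl A M (Ideal.Quotient.mk A a • x) = a • coreflectIncl A M x := rfl

lemma coreflectIncl_injective (M : FGModuleCat.{u} Λ) : Function.Injective (coreflectIncl A M) :=
  (annSubmodule A M).injective_subtype

variable {A} in
lemma exists_coreflectIncl_eq {M : FGModuleCat.{u} Λ} {x : M} (hx : ∀ a ∈ A, a • x = 0) :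
    ∃ y, coreflectIncl A M y = x :=
  ⟨(⟨x, hx⟩ : annSubmodule A M), rfl⟩

/-- A `Λ/A`-linear map into `{x | A x = 0}` is a `Λ`-linear map into `M`. -/
lemma exists_coreflect_lift {M : FGModuleCat.{u} Λ} {Y : Type u} [AddCommGroup Y]
    [Module (Λ ⧸ A) Y] (φ : Y →+ M)
    (hφ : ∀ (a : Λ) (y : Y), φ (Ideal.Quotient.mk A a • y) = a • φ y) :
    ∃ ψ : Y →ₗ[Λ ⧸ A] coreflect A M, ∀ y, coreflectIncl A M (ψ y) = φ y := by
  have h : ∀ y, ∃ z, coreflectIncl A M z = φ y := fun y =>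
    exists_coreflectIncl_eq fun a ha => by
      rw [← hφ, Ideal.Quotient.eq_zero_iff_mem.2 ha, zero_smul, map_zero]
  choose ψ hψ using h
  refine ⟨{ toFun := ψ, map_add' := fun x y => ?_, map_smul' := fun b x => ?_ }, hψ⟩
  · apply coreflectIncl_injective
    rw [map_add, hψ, hψ, hψ, map_add]
  · obtain ⟨a, rfl⟩ := Ideal.Quotient.mk_surjective b
    apply coreflectIncl_injective
    rw [hψ, hφ, RingHom.id_apply, coreflectIncl_smul, hψ]

/-- The restriction of a linear map to the elements killed by `A`. -/
def coreflectMap {M N : FGModuleCat.{u} Λ} (f : M →ₗ[Λ] N) :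
    coreflect A M →ₗ[Λ ⧸ A] coreflect A N :=
  (exists_coreflect_lift A (Y := coreflect A M) (f.toAddMonoidHom.comp (coreflectIncl A M))
    fun a x => by simp [coreflectIncl_smul]).choose

@[simp]
lemma coreflectIncl_map {M N : FGModuleCat.{u} Λ} (f : M →ₗ[Λ] N) (x : coreflect A M) :
    coreflectIncl A N (coreflectMap A f x) = f (coreflectIncl A M x) :=
  (exists_coreflect_lift A (Y := coreflect A M) (f.toAddMonoidHom.comp (coreflectIncl A M))
    fun a x => by simp [coreflectIncl_smul]).choose_spec x

/-- The coreflection is additive. -/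
def coreflectProdEquiv {L M N : FGModuleCat.{u} Λ} (e : N ≃ₗ[Λ] (L × M)) :
    coreflect A N ≃ₗ[Λ ⧸ A] (coreflect A L × coreflect A M) :=
  LinearEquiv.ofLinearMap
    ((coreflectMap A (LinearMap.fst Λ L M ∘ₗ e.toLinearMap)).prod
      (coreflectMap A (LinearMap.snd Λ L M ∘ₗ e.toLinearMap)))
    ((coreflectMap A (e.symm.toLinearMap ∘ₗ LinearMap.inl Λ L M)).coprod
      (coreflectMap A (e.symm.toLinearMap ∘ₗ LinearMap.inr Λ L M)))
    (LinearMap.ext fun x => Prod.ext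
      (coreflectIncl_injective A L (by simp)) (coreflectIncl_injective A M (by simp)))
    (LinearMap.ext fun x => coreflectIncl_injective A N (by
      rw [LinearMap.comp_apply, LinearMap.coprod_apply, map_add, coreflectIncl_map,
        coreflectIncl_map, LinearMap.prod_apply]
      simp [← map_add]))

/-- Coreflection is right adjoint to inflation, which preserves injections. -/
lemma injective_coreflect {I : FGModuleCat.{u} Λ} (hI : Inj I) : Inj (coreflect A I) := by
  refine ⟨fun X Y _ _ _ _ i hi f => ?_⟩
  let _ : Module Λ X := Module.compHom X (Ideal.Quotient.mk A)
  let _ : Module Λ Y := Module.compHom Y (Ideal.Quotient.mk A)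
  let i' : X →ₗ[Λ] Y := { i with map_smul' := fun a x => i.map_smul (Ideal.Quotient.mk A a) x }
  let f' : X →ₗ[Λ] I :=
    { toFun := fun x => coreflectIncl A I (f x)
      map_add' := fun x y => by rw [map_add, map_add]
      map_smul' := fun a x =>
        (congrArg _ (f.map_smul (Ideal.Quotient.mk A a) x)).trans (coreflectIncl_smul A a (f x)) }
  obtain ⟨h, hh⟩ := hI.out i' hi f'
  obtain ⟨k, hk⟩ := exists_coreflect_lift A h.toAddMonoidHom fun a y => h.map_smul a y
  exact ⟨k, fun x => coreflectIncl_injective A I ((hk (i x)).trans (hh x))⟩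

/-- A `Λ/A`-module is its own coreflection. -/
lemma cls_coreflect_inflate {Null : FGModuleCat.{u} (Λ ⧸ A) → Prop} (X : FGModuleCat.{u} (Λ ⧸ A)) :
    cls Null (coreflect A (inflate X)) = cls Null X := by
  obtain ⟨ψ, hψ⟩ := exists_coreflect_lift A (M := inflate X) (Y := X) (AddMonoidHom.id X)
    fun _ _ => rfl
  refine (cls_congr (LinearEquiv.ofBijective ψ ⟨fun x y h => ?_, fun y => ?_⟩)).symm
  · exact (hψ x).symm.trans ((congrArg _ h).trans (hψ y))
  · exact ⟨coreflectIncl A (inflate X) y, coreflectIncl_injective A _ (hψ _)⟩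

end Coreflect

/-! ### Character duals of right modules -/

section RightDual

variable {Λ : Type u} [Ring Λ]

/-- The group of characters of `T`. -/
def RightDual (T : Type u) [AddCommGroup T] : Type u := T →+ AddCircle (1 : ℚ)

instance (T : Type u) [AddCommGroup T] : AddCommGroup (RightDual T) :=
  inferInstanceAs (AddCommGroup (T →+ AddCircle (1 : ℚ)))

instance (T : Type u) [AddCommGroup T] : FunLike (RightDual T) T (AddCircle (1 : ℚ)) :=
  inferInstanceAs (FunLike (T →+ AddCircle (1 : ℚ)) T (AddCircle (1 : ℚ)))

instance (T : Type u) [AddCommGroup T] : AddMonoidHomClass (RightDual T) T (AddCircle (1 : ℚ)) :=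
  inferInstanceAs (AddMonoidHomClass (T →+ AddCircle (1 : ℚ)) T (AddCircle (1 : ℚ)))

/-- The characters of a right module form a left module. -/
instance (T : Type u) [AddCommGroup T] [Module Λᵐᵒᵖ T] : Module Λ (RightDual T) where
  smul a c := (show T →+ AddCircle (1 : ℚ) from c).comp
    (DistribSMul.toAddMonoidHom T (MulOpposite.op a))
  one_smul c := DFunLike.ext _ _ fun t => congrArg c (one_smul _ t)
  mul_smul a b c := DFunLike.ext _ _ fun t => congrArg c
    (mul_smul (MulOpposite.op b) (MulOpposite.op a) t)
  smul_zero _ := rfl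
  smul_add _ _ _ := rfl
  add_smul a b c := DFunLike.ext _ _ fun t =>
    (congrArg c (add_smul (MulOpposite.op a) (MulOpposite.op b) t)).trans (map_add c _ _)
  zero_smul c := DFunLike.ext _ _ fun t =>
    (congrArg c (zero_smul Λᵐᵒᵖ t)).trans (map_zero c)

/-- The transpose of a homomorphism of right modules. -/
def RightDual.map {S T : Type u} [AddCommGroup S] [AddCommGroup T] [Module Λᵐᵒᵖ S]
    [Module Λᵐᵒᵖ T] (f : S →ₗ[Λᵐᵒᵖ] T) : RightDual T →ₗ[Λ] RightDual S where
  toFun c := (show T →+ AddCircle (1 : ℚ) from c).comp f.toAddMonoidHom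
  map_add' _ _ := rfl
  map_smul' a c := DFunLike.ext _ _ fun s => (congrArg c (f.map_smul (MulOpposite.op a) s)).symm

lemma RightDual.map_apply {S T : Type u} [AddCommGroup S] [AddCommGroup T] [Module Λᵐᵒᵖ S]
    [Module Λᵐᵒᵖ T] (f : S →ₗ[Λᵐᵒᵖ] T) (c : RightDual T) (s : S) : map f c s = c (f s) := rfl

/-- Characters extend along injective homomorphisms. -/
lemma exists_character_extension {S T : Type u} [AddCommGroup S] [AddCommGroup T] (f : S →+ T)
    (hf : Function.Injective f) (c : S →+ AddCircle (1 : ℚ)) :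
    ∃ d : T →+ AddCircle (1 : ℚ), ∀ s, d (f s) = c s := by
  obtain ⟨d, hd⟩ := CharacterModule.dual_surjective_of_injective f.toIntLinearMap hf c
  exact ⟨d, fun s => DFunLike.congr_fun hd s⟩

/-- Characters of a free right module are determined freely on a basis, so a map into the dual
extends one basis element at a time by divisibility of `ℚ/ℤ`. The projective case follows by the
splitting `s` of the canonical free cover of `T`. -/
lemma injective_rightDual {T : Type u} [AddCommGroup T] [Module Λᵐᵒᵖ T]
    (hT : Module.Projective Λᵐᵒᵖ T) : Module.Injective Λ (RightDual T) := by
  obtain ⟨s, hs⟩ := hT.out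
  refine ⟨fun X Y _ _ _ _ i hi f => ?_⟩
  -- The extensions `d t` are chosen independently, with no linearity in `t`; passing to the free
  -- module on `T` makes this harmless.
  have hext : ∀ t : T, ∃ d : Y →+ AddCircle (1 : ℚ), ∀ x, d (i x) = f x t := fun t =>
    exists_character_extension i.toAddMonoidHom hi
      { toFun := fun x => f x t
        map_zero' := by rw [map_zero]; rfl
        map_add' := fun x y => by rw [map_add]; rfl }
  choose d hd using hext
  let G : Y → (T →₀ Λᵐᵒᵖ) →+ AddCircle (1 : ℚ) := fun y =>
    Finsupp.liftAddHom fun t =>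
      { toFun := fun a => d t (a.unop • y)
        map_zero' := by simp
        map_add' := fun a b => by rw [MulOpposite.unop_add, add_smul, map_add] }
  have hG : ∀ y t a, G y (Finsupp.single t a) = d t (a.unop • y) := fun y t a => by simp [G]
  have hGadd : ∀ x y, G (x + y) = G x + G y := fun x y => by
    refine Finsupp.addHom_ext fun t a => ?_
    rw [AddMonoidHom.add_apply, hG, hG, hG, smul_add, map_add]
  have hGsmul : ∀ (a : Λ) y z, G (a • y) z = G y (MulOpposite.op a • z) := fun a y z => by
    induction z using Finsupp.induction_linear with
    | zero => rw [smul_zero, map_zero, map_zero]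
    | add z w hz hw => rw [smul_add, map_add, map_add, hz, hw]
    | single t b =>
      rw [Finsupp.smul_single, hG, hG, smul_smul]
      rfl
  -- On the image of `i` the arbitrary choices disappear: `G (i x)` depends on `z` only through its
  -- image in `T`, and composing with `s` recovers `f x`.
  have hGi : ∀ x z, G (i x) z = f x (Finsupp.linearCombination Λᵐᵒᵖ id z) := fun x z => by
    induction z using Finsupp.induction_linear with
    | zero => rw [map_zero, map_zero, map_zero]
    | add z w hz hw => rw [map_add, map_add, map_add, hz, hw]
    | single t b =>
      rw [hG, ← map_smul, hd, map_smul, Finsupp.linearCombination_single]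
      rfl
  refine ⟨{ toFun := fun y => (G y).comp s.toAddMonoidHom
            map_add' := fun x y => ?_
            map_smul' := fun a y => ?_ }, fun x => DFunLike.ext _ _ fun t => ?_⟩
  · rw [hGadd]
    rfl
  · refine DFunLike.ext _ _ fun t => (hGsmul a y (s t)).trans ?_
    exact congrArg (G y) (s.map_smul (MulOpposite.op a) t).symm
  · refine (hGi x (s t)).trans ?_
    rw [hs t]

/-- The character dual of a right module of projective dimension at most `n` has injective
dimension at most `n`. -/
lemma hasInjectiveDimensionLT_rightDual {n : ℕ} {T : Type u} [AddCommGroup T] [Module Λᵐᵒᵖ T]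
    (hT : HasProjectiveDimensionLT (ModuleCat.of Λᵐᵒᵖ T) (n + 1)) :
    HasInjectiveDimensionLT (ModuleCat.of Λ (RightDual T)) (n + 1) := by
  induction n generalizing T with
  | zero =>
    exact injective_iff_hasInjectiveDimensionLT_one.1
      ((Module.injective_iff_injective_object Λ _).1 (injective_rightDual
        ((IsProjective.iff_projective T).2 (projective_iff_hasProjectiveDimensionLT_one.2 hT))))
  | succ n ih =>
    let p : (T →₀ Λᵐᵒᵖ) →ₗ[Λᵐᵒᵖ] T := Finsupp.linearCombination Λᵐᵒᵖ id
    have hp : Function.Surjective p :=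
      Finsupp.linearCombination_surjective _ Function.surjective_id
    have hF : Module.Projective Λᵐᵒᵖ (T →₀ Λᵐᵒᵖ) := inferInstance
    have := (IsProjective.iff_projective (T →₀ Λᵐᵒᵖ)).1 hF
    have hK : HasProjectiveDimensionLT (ModuleCat.of Λᵐᵒᵖ p.ker) (n + 1) :=
      (shortExact_moduleCatMk p.ker.injective_subtype (LinearMap.exact_subtype_ker_map p)
        hp).hasProjectiveDimensionLT_X₁ (n + 1)
        (hasProjectiveDimensionLT_of_ge (ModuleCat.of Λᵐᵒᵖ (T →₀ Λᵐᵒᵖ)) 1 (n + 1) (by omega)) hT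
    have := (Module.injective_iff_injective_object Λ _).1 (injective_rightDual hF)
    -- Dualizing `0 → K → F → T → 0` puts `T*` first, with `F*` injective and `K*` covered by
    -- induction.
    refine (shortExact_moduleCatMk (f := RightDual.map p) (g := RightDual.map p.ker.subtype)
      ?_ ?_ ?_).hasInjectiveDimensionLT_X₁ (n + 1) (ih hK)
      (hasInjectiveDimensionLT_of_ge (ModuleCat.of Λ (RightDual (T →₀ Λᵐᵒᵖ))) 1 _ (by omega))
    · intro c d h
      refine DFunLike.ext _ _ fun t => ?_
      obtain ⟨z, rfl⟩ := hp t
      exact DFunLike.congr_fun h z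
    · intro c
      constructor
      · intro hc
        have hc' : ∀ z, p z = 0 → c z = 0 := fun z hz =>
          DFunLike.congr_fun hc (⟨z, hz⟩ : p.ker)
        have hle : p.toAddMonoidHom.ker ≤ (show (T →₀ Λᵐᵒᵖ) →+ AddCircle (1 : ℚ) from c).ker :=
          fun z hz => hc' z hz
        refine ⟨p.toAddMonoidHom.liftOfSurjective hp
          ⟨show (T →₀ Λᵐᵒᵖ) →+ AddCircle (1 : ℚ) from c, hle⟩, DFunLike.ext _ _ fun z => ?_⟩
        exact p.toAddMonoidHom.liftOfRightInverse_comp_apply _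
          (Function.rightInverse_surjInv hp) _ z
      · rintro ⟨d, rfl⟩
        refine DFunLike.ext _ _ fun z => ?_
        rw [RightDual.map_apply, RightDual.map_apply]
        exact (congrArg d z.2).trans (map_zero d)
    · intro c
      obtain ⟨d, hd⟩ := exists_character_extension p.ker.subtype.toAddMonoidHom
        p.ker.injective_subtype c
      exact ⟨d, DFunLike.ext _ _ hd⟩

/-- A finitely generated module over an artinian ring embeds into a finite power of the character
dual of the ring. -/
lemma exists_embedding_rightDual [IsArtinianRing Λ] (M : Type u) [AddCommGroup M] [Module Λ M]
    [Module.Finite Λ M] :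
    ∃ (n : ℕ) (f : M →ₗ[Λ] (Fin n → RightDual Λ)), Function.Injective f := by
  -- A character `c` of `M` gives the linear map sending `x` to the character `b ↦ c (b x)`;
  -- evaluation at `1` recovers `c x`.
  let F : CharacterModule M → M →ₗ[Λ] RightDual Λ := fun c =>
    { toFun := fun x => (show M →+ AddCircle (1 : ℚ) from c).comp
        ((LinearMap.toSpanSingleton Λ M x).toAddMonoidHom)
      map_add' := fun x y => DFunLike.ext _ _ fun b =>
        (congrArg c (smul_add b x y)).trans (map_add c _ _)
      map_smul' := fun a x => DFunLike.ext _ _ fun b => congrArg c (smul_smul b a x) }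
  have hF : ∀ c x, F c x 1 = c x := fun c x => congrArg c (one_smul Λ x)
  -- By the descending chain condition finitely many kernels already have the intersection of all of
  -- them, which is zero because characters separate points.
  obtain ⟨t, ht⟩ := Finset.exists_inf_le fun c => (F c).ker
  refine ⟨t.card, LinearMap.pi fun j => F (t.equivFin.symm j), ?_⟩
  rw [← LinearMap.ker_eq_bot, LinearMap.ker_eq_bot']
  intro x hx
  have hxt : x ∈ t.inf fun c => (F c).ker := by
    rw [Submodule.mem_finsetInf]
    intro c hc
    have := congrFun hx (t.equivFin ⟨c, hc⟩)
    simpa using this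
  refine CharacterModule.eq_zero_of_character_apply fun c => ?_
  have hc : F c x = 0 := ht c hxt
  rw [← hF, hc]
  rfl

end RightDual

/-! ### The comparison for cosyzygies -/

section Right

variable {Λ : Type u} [Ring Λ] {A : Ideal Λ} [A.IsTwoSided]

variable (A) in
/-- All higher extensions of `Λ/A` by `M` vanish. -/
def ExtQuotVanish (M : FGModuleCat.{u} Λ) : Prop :=
  ∀ (i : ℕ) (e : Abelian.Ext (inflate (FGModuleCat.of (Λ ⧸ A) (Λ ⧸ A))).obj M.obj (i + 1)), e = 0

/-- Such an extension comes from one over `Λ/A`, where the first argument is free. -/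
lemma IsStrongIdempotent.extQuotVanish (hA : IsStrongIdempotent A) (X : FGModuleCat.{u} (Λ ⧸ A)) :
    ExtQuotVanish A (inflate X) := by
  intro i e
  have : Projective (FGModuleCat.of (Λ ⧸ A) (Λ ⧸ A)).obj :=
    (IsProjective.iff_projective (R := Λ ⧸ A) (Λ ⧸ A)).1 inferInstance
  obtain ⟨e', rfl⟩ := (hA _ X (i + 1)).2 e
  rw [Abelian.Ext.eq_zero_of_projective e']
  exact map_zero _

/-- Dimension shift: a class on `N` has zero connecting image on `M`, so it comes from the injective
`I`. -/
lemma ExtQuotVanish.cosyzygy {M N : FGModuleCat.{u} Λ} (hM : ExtQuotVanish A M)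
    (h : IsCosyzygy M N) : ExtQuotVanish A N := by
  intro i e
  obtain ⟨I, f, g, hI, hf, hfg, hg⟩ := h
  have hI' : Injective I.obj := (Module.injective_iff_injective_object Λ I).1 hI
  obtain ⟨x, rfl⟩ := Abelian.Ext.covariant_sequence_exact₃ _
    (shortExact_moduleCatMk hf hfg hg) e rfl (hM _ _)
  have hx : x = 0 := Abelian.Ext.eq_zero_of_injective (I := I.obj) x
  rw [hx, Abelian.Ext.zero_comp]
  rfl

lemma ExtQuotVanish.exists_lift {M I N : FGModuleCat.{u} Λ} (hM : ExtQuotVanish A M)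
    {f : M →ₗ[Λ] I} {g : I →ₗ[Λ] N} (hf : Function.Injective f) (hfg : Function.Exact f g)
    (hg : Function.Surjective g) (φ : inflate (FGModuleCat.of (Λ ⧸ A) (Λ ⧸ A)) →ₗ[Λ] N) :
    ∃ ψ : inflate (FGModuleCat.of (Λ ⧸ A) (Λ ⧸ A)) →ₗ[Λ] I, g ∘ₗ ψ = φ := by
  let φ' : (inflate (FGModuleCat.of (Λ ⧸ A) (Λ ⧸ A))).obj ⟶ N.obj := ConcreteCategory.ofHom φ
  obtain ⟨x, hx⟩ := Abelian.Ext.covariant_sequence_exact₃ _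
    (shortExact_moduleCatMk hf hfg hg) (Abelian.Ext.mk₀ φ') (zero_add 1) (hM _ _)
  obtain ⟨ψ, rfl⟩ := Abelian.Ext.homEquiv₀.symm.surjective x
  refine ⟨ψ.hom, ?_⟩
  rw [Abelian.Ext.homEquiv₀_symm_apply, Abelian.Ext.mk₀_comp_mk₀] at hx
  exact congrArg ModuleCat.Hom.hom ((Abelian.Ext.mk₀_bijective _ _).1 hx)

/-- Coreflection is left exact in any case. For surjectivity, an element of `N` killed by `A` is a
map `Λ/A → N`; the vanishing of `Ext^1(Λ/A, M)` lifts it to `I`, and the image of `1` is a preimage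
killed by `A`. -/
lemma IsCosyzygy.coreflect [IsNoetherianRing Λ] {M N : FGModuleCat.{u} Λ}
    (hM : ExtQuotVanish A M) (h : IsCosyzygy M N) :
    IsCosyzygy (coreflect A M) (coreflect A N) := by
  obtain ⟨I, f, g, hI, hf, hfg, hg⟩ := h
  have hgf : ∀ x, g (f x) = 0 := hfg.apply_apply_eq_zero
  refine ⟨IgusaTodorov.coreflect A I, coreflectMap A f, coreflectMap A g,
    injective_coreflect A hI, ?_, ?_, ?_⟩
  · intro x y hxy
    have := congrArg (coreflectIncl A I) hxy
    rw [coreflectIncl_map, coreflectIncl_map] at this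
    exact coreflectIncl_injective A M (hf this)
  · intro y
    constructor
    · intro hy
      have := congrArg (coreflectIncl A N) hy
      rw [coreflectIncl_map, map_zero] at this
      obtain ⟨m, hm⟩ := (hfg _).1 this
      obtain ⟨x, rfl⟩ := exists_coreflectIncl_eq (A := A) (x := m) fun a ha => hf (by
        rw [map_smul, hm, ← coreflectIncl_smul, Ideal.Quotient.eq_zero_iff_mem.2 ha, zero_smul,
          map_zero, map_zero])
      exact ⟨x, coreflectIncl_injective A I (by rw [coreflectIncl_map, hm])⟩
    · rintro ⟨x, rfl⟩
      exact coreflectIncl_injective A N (by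
        rw [coreflectIncl_map, coreflectIncl_map, hgf, map_zero])
  · intro y
    let φ : inflate (FGModuleCat.of (Λ ⧸ A) (Λ ⧸ A)) →ₗ[Λ] N :=
      { toFun := fun b => coreflectIncl A N ((show Λ ⧸ A from b) • y)
        map_add' := fun b c => (congrArg _ (add_smul (R := Λ ⧸ A) _ _ y)).trans (map_add _ _ _)
        map_smul' := fun a b => (congrArg _ (mul_smul (Ideal.Quotient.mk A a) _ y)).trans
          (coreflectIncl_smul A a _) }
    obtain ⟨ψ, hψ⟩ := hM.exists_lift hf hfg hg φ
    obtain ⟨x, hx⟩ := exists_coreflectIncl_eq (A := A) (x := ψ (1 : Λ ⧸ A)) fun a ha => by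
      refine (ψ.map_smul a (1 : Λ ⧸ A)).symm.trans ((congrArg ψ ?_).trans (map_zero ψ))
      exact (mul_one (Ideal.Quotient.mk A a)).trans (Ideal.Quotient.eq_zero_iff_mem.2 ha)
    refine ⟨x, coreflectIncl_injective A N ?_⟩
    rw [coreflectIncl_map, hx]
    refine (LinearMap.congr_fun hψ (1 : Λ ⧸ A)).trans ?_
    exact congrArg (coreflectIncl A N) (one_smul (Λ ⧸ A) y)

/-- The homomorphism of stable groups induced by the coreflection. -/
def stableCoreflect (A : Ideal Λ) [A.IsTwoSided] [IsNoetherianRing Λ] :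
    StableK (Inj (Λ := Λ)) →+ StableK (Inj (Λ := Λ ⧸ A)) :=
  stableLift (fun M => cls Inj (coreflect A M)) (fun _ _ _ e => cls_sum (coreflectProdEquiv A e))
    fun _ hZ => cls_null (injective_coreflect A hZ)

lemma stableCoreflect_iterate (R : Type v) [CommRing R] [IsArtinianRing R] [Algebra R Λ]
    [Module.Finite R Λ] [IsNoetherianRing Λ] {ω : StableK (Inj (Λ := Λ)) →+ StableK (Inj (Λ := Λ))}
    {ω' : StableK (Inj (Λ := Λ ⧸ A)) →+ StableK (Inj (Λ := Λ ⧸ A))}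
    (hω : IsInduced Inj IsCosyzygy ω) (hω' : IsInduced Inj IsCosyzygy ω') (s : ℕ)
    {M : FGModuleCat.{u} Λ} (hM : ExtQuotVanish A M) :
    stableCoreflect A (ω^[s] (cls Inj M)) = ω'^[s] (cls Inj (coreflect A M)) := by
  induction s generalizing M with
  | zero => exact stableLift_cls _ _ _ M
  | succ s ih =>
    obtain ⟨N, hN⟩ := exists_isCosyzygy R M
    rw [Function.iterate_succ_apply, Function.iterate_succ_apply, hω M N hN, ih (hM.cosyzygy hN),
      hω' _ _ (hN.coreflect hM)]

/-- An injective `Λ/A`-module splits off any module in which it embeds, here a finite power of the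
character dual of `Λ/A`. Over `Λ` this is the dual of the right module `rightQuot A`, whose
injective dimension is bounded. -/
lemma hasInjectiveDimensionLT_inflate [IsArtinianRing (Λ ⧸ A)] {n : ℕ}
    (hn : HasProjectiveDimensionLT (rightQuot A) (n + 1))
    {I : FGModuleCat.{u} (Λ ⧸ A)} (hI : Inj I) :
    HasInjectiveDimensionLT (inflate I).obj (n + 1) := by
  obtain ⟨m, s, hs⟩ := exists_embedding_rightDual (Λ := Λ ⧸ A) I
  obtain ⟨g, hg⟩ := hI.out s hs LinearMap.id
  let s' : inflate I →ₗ[Λ] (Fin m → RightDual (rightQuot A)) :=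
    { toFun := s
      map_add' := s.map_add
      map_smul' := fun a x => s.map_smul (Ideal.Quotient.mk A a) x }
  let g' : (Fin m → RightDual (rightQuot A)) →ₗ[Λ] inflate I :=
    { toFun := g
      map_add' := g.map_add
      map_smul' := fun a x => g.map_smul (Ideal.Quotient.mk A a) x }
  have hr : Retract (inflate I).obj (ModuleCat.of Λ (Fin m → RightDual (rightQuot A))) :=
    retractOfLinearMap (X := (inflate I).obj) s' g' hg
  have := hasInjectiveDimensionLT_fin (hasInjectiveDimensionLT_rightDual (T := rightQuot A) hn) m
  exact @Retract.hasInjectiveDimensionLT _ _ _ _ _ hr (n + 1) this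

theorem phiR_le_phiR_inflate (R : Type v) [CommRing R] [IsArtinianRing R] [Algebra R Λ]
    [Module.Finite R Λ] (hA : IsStrongIdempotent A) (hpd : projectiveDimension (rightQuot A) < ⊤)
    (X : FGModuleCat.{u} (Λ ⧸ A)) : phiR X ≤ phiR (inflate X) := by
  have : IsArtinianRing Λ := IsArtinianRing.of_finite R Λ
  have : IsArtinianRing (Λ ⧸ A) := IsArtinianRing.of_finite R (Λ ⧸ A)
  obtain ⟨n, hn⟩ := (projectiveDimension_ne_top_iff _).1 hpd.ne
  have hω := isInduced_inducedHom_cosyzygy (Λ := Λ) R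
  have hω' := isInduced_inducedHom_cosyzygy (Λ := Λ ⧸ A) R
  -- As for syzygies, the `n` cosyzygies kill the injective `Λ/A`-modules, whose injective dimension
  -- over `Λ` is at most `n`.
  let i : StableK (Inj (Λ := Λ ⧸ A)) →+ StableK (Inj (Λ := Λ)) :=
    stableLift (fun X => (inducedHom Inj IsCosyzygy)^[n] (cls Inj (inflate X)))
      (fun _ _ _ e => by rw [cls_sum (inflateProdEquiv e), iterate_map_add])
      fun _ hZ => iterate_cosyzygy_cls_eq_zero R hω (hasInjectiveDimensionLT_inflate hn hZ)
  have hi : ∀ X, i (cls Inj X) = (inducedHom Inj IsCosyzygy)^[n] (cls Inj (inflate X)) :=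
    stableLift_cls _ _ _
  have hcomm : i.comp (inducedHom Inj IsCosyzygy) = (inducedHom Inj IsCosyzygy).comp i := by
    apply QuotientAddGroup.addMonoidHom_ext
    ext M
    change i (inducedHom Inj IsCosyzygy (cls Inj M)) = inducedHom Inj IsCosyzygy (i (cls Inj M))
    obtain ⟨N, hN⟩ := exists_isCosyzygy R M
    rw [hω' M N hN, hi, hi, ← Function.iterate_succ_apply' (inducedHom Inj IsCosyzygy)]
    obtain ⟨P, f, g, hP, hf, hfg, hg⟩ := hN
    exact (iterate_succ_cosyzygy_cls_eq R hω (f := inflateHom f) (g := inflateHom g) hf hfg hg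
      (hasInjectiveDimensionLT_inflate hn hP)).symm
  refine stabIndex_addSpan_le (stableCoreflect A) i n (fun X s => ?_) hi
    (fun x => DFunLike.congr_fun hcomm x) X
  rw [stableCoreflect_iterate R hω hω' s (hA.extQuotVanish X), cls_coreflect_inflate]

end Right

end

end IgusaTodorov

open IgusaTodorov in
theorem theorem4p3 (R : Type v) [CommRing R] [IsArtinianRing R]
    (Λ : Type u) [Ring Λ] [Algebra R Λ] [Module.Finite R Λ]
    (A : Ideal Λ) [A.IsTwoSided] (hA : IsStrongIdempotent A) :
    (projectiveDimension (leftQuot A) < ⊤ →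
      (∀ X : FGModuleCat.{u} (Λ ⧸ A), phiL X ≤ phiL (inflate X)) ∧
        phiLDim (Λ ⧸ A) ≤ phiLDim Λ) ∧
    (projectiveDimension (rightQuot A) < ⊤ →
      (∀ X : FGModuleCat.{u} (Λ ⧸ A), phiR X ≤ phiR (inflate X)) ∧
        phiRDim (Λ ⧸ A) ≤ phiRDim Λ) := by
  refine ⟨fun h => ?_, fun h => ?_⟩
  · have hX := phiL_le_phiL_inflate R hA h
    exact ⟨hX, iSup_le fun X => (hX X).trans (le_iSup phiL (inflate X))⟩
  · have hX := phiR_le_phiR_inflate R hA h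
    exact ⟨hX, iSup_le fun X => (hX X).trans (le_iSup phiR (inflate X))⟩
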